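/- Let $\Sigma$ be a connected real-analytic $2$-manifold and let $f:\Sigma\to\mathbb H^3$ be a real-analytic immersion into hyperbolic $3$-space whose induced metric is complete. Assume that $f$ is developable, that is, ruled (around each point of $\Sigma$ there are coordinates $(s,t)$ in which $f(s,t)=c(s)\cosh t+v(s)\sinh t$ in the hyperboloid model, where $c$ is a curve in $\mathbb H^3$ and $v$ is a unit normal vector field along $c$) and extrinsically flat (the product of the principal curvatures vanishes identically). Assume moreover that $f$ is of exponential type: $f$ is not totally umbilic and, on each asymptotic curve in the set of non-umbilic points, parametrized by arc length $t$, the mean curvature of $f$ is proportional to $e^{t}$ or to $e^{-t}$. (A curve is asymptotic if its tangent lines are the kernels of the second fundamental form.) Then $f$ is an ideal cone: it is the locus of a one-parameter family of geodesics of $\mathbb H^3$ which share one end point in the ideal boundary $\partial\mathbb H^3$. Moreover, the complete asymptotic curves in the non-umbilic set are, with suitable orientations, mutually asymptotic: any two of them, $\gamma_1,\gamma_2$, parametrized by arc length, satisfy $\sup_{t>0}d\bigl(f(\gamma_1(t)),f(\gamma_2(t))\bigr)<\infty$, where $d$ is the hyperbolic distance. -/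

import Mathlib

open scoped Manifold ContDiff Topology ENNReal

noncomputable section

namespace HypSurf

/-! ### Hyperbolic 3-space in the Lorentz-Minkowski model -/

/-- The vector space underlying Lorentz-Minkowski `4`-space. -/
abbrev L4 : Type := Fin 4 → ℝ

/-- The Lorentz metric `-x₀y₀ + x₁y₁ + x₂y₂ + x₃y₃`. -/
def lorentz (x y : L4) : ℝ := -(x 0 * y 0) + x 1 * y 1 + x 2 * y 2 + x 3 * y 3

/-- Hyperbolic `3`-space, the upper sheet of the two-sheeted hyperboloid. -/
def H3 : Set L4 := {x | lorentz x x = -1 ∧ 0 < x 0}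

/-- The hyperbolic distance, `cosh d(x, y) = -⟨x, y⟩`. -/
def hypDist (x y : L4) : ℝ := Real.arcosh (-lorentz x y)

/-- `v` is a unit tangent vector of hyperbolic space at the point `p`. -/
def IsUnitTangent (p v : L4) : Prop := p ∈ H3 ∧ lorentz p v = 0 ∧ lorentz v v = 1

/-- The unit speed geodesic `t ↦ cosh t • p + sinh t • v` (for a unit tangent vector `v` at `p`). -/
def geod (p v : L4) (t : ℝ) : L4 := Real.cosh t • p + Real.sinh t • v

/-- Two curves in hyperbolic space are asymptotic if `{d(σ t, τ t) | t > 0}` is bounded above. -/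
def Asymptotic (σ τ : ℝ → L4) : Prop :=
  BddAbove ((fun t => hypDist (σ t) (τ t)) '' Set.Ioi 0)

/-- The unit tangent bundle of hyperbolic space, i.e. the set of unit speed geodesics. -/
def UH3 : Type := {g : L4 × L4 // IsUnitTangent g.1 g.2}

/-- The unit speed geodesic given by a unit tangent vector. -/
def UH3.curve (g : UH3) : ℝ → L4 := geod g.1.1 g.1.2

theorem lorentz_comm (x y : L4) : lorentz x y = lorentz y x := by
  simp only [lorentz]; ring

theorem UH3.curve_mem (g : UH3) (t : ℝ) : g.curve t ∈ H3 := by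
  obtain ⟨⟨p, v⟩, ⟨hp, hp0⟩, hpv, hv⟩ := g
  have hcs := Real.cosh_sq t
  simp only [lorentz] at hp hpv hv hp0
  refine ⟨?_, ?_⟩
  · simp only [UH3.curve, geod, lorentz, Pi.add_apply, Pi.smul_apply, smul_eq_mul]
    linear_combination (Real.cosh t) ^ 2 * hp + 2 * Real.cosh t * Real.sinh t * hpv
      + (Real.sinh t) ^ 2 * hv - hcs
  · simp only [UH3.curve, geod, Pi.add_apply, Pi.smul_apply, smul_eq_mul]
    have hc := Real.cosh_pos t
    have hcs' : (Real.sinh t) ^ 2 < (Real.cosh t) ^ 2 := by linarith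
    have hpv2 : (p 0 * v 0) ^ 2
        ≤ (p 1 ^ 2 + p 2 ^ 2 + p 3 ^ 2) * (v 1 ^ 2 + v 2 ^ 2 + v 3 ^ 2) := by
      have : p 0 * v 0 = p 1 * v 1 + p 2 * v 2 + p 3 * v 3 := by linarith
      rw [this]
      nlinarith [sq_nonneg (p 1 * v 2 - p 2 * v 1), sq_nonneg (p 1 * v 3 - p 3 * v 1),
        sq_nonneg (p 2 * v 3 - p 3 * v 2)]
    have e1 : p 1 ^ 2 + p 2 ^ 2 + p 3 ^ 2 = p 0 ^ 2 - 1 := by linarith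
    have e2 : v 1 ^ 2 + v 2 ^ 2 + v 3 ^ 2 = v 0 ^ 2 + 1 := by linarith
    rw [e1, e2] at hpv2
    have hv0 : v 0 ^ 2 < p 0 ^ 2 := by nlinarith
    have hlt : (Real.sinh t * v 0) ^ 2 < (Real.cosh t * p 0) ^ 2 := by
      rw [mul_pow, mul_pow]
      have h1 : Real.sinh t ^ 2 * v 0 ^ 2 ≤ Real.cosh t ^ 2 * v 0 ^ 2 :=
        mul_le_mul_of_nonneg_right hcs'.le (sq_nonneg _)
      have h2 : Real.cosh t ^ 2 * v 0 ^ 2 < Real.cosh t ^ 2 * p 0 ^ 2 :=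
        mul_lt_mul_of_pos_left hv0 (by positivity)
      linarith
    have := abs_lt_of_sq_lt_sq hlt (by positivity)
    linarith [(abs_lt.mp this).1]

theorem lorentz_nonneg_of_orthogonal {y w : L4} (hy : y ∈ H3) (h : lorentz w y = 0) :
    0 ≤ lorentz w w := by
  obtain ⟨hy1, hy0⟩ := hy
  simp only [lorentz] at *
  have hw : w 0 * y 0 = w 1 * y 1 + w 2 * y 2 + w 3 * y 3 := by linarith
  have hcs : (w 0 * y 0) ^ 2
      ≤ (w 1 ^ 2 + w 2 ^ 2 + w 3 ^ 2) * (y 1 ^ 2 + y 2 ^ 2 + y 3 ^ 2) := by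
    rw [hw]
    nlinarith [sq_nonneg (w 1 * y 2 - w 2 * y 1), sq_nonneg (w 1 * y 3 - w 3 * y 1),
      sq_nonneg (w 2 * y 3 - w 3 * y 2)]
  have e1 : y 1 ^ 2 + y 2 ^ 2 + y 3 ^ 2 = y 0 ^ 2 - 1 := by linarith
  rw [e1] at hcs
  have hy2 : 0 < y 0 ^ 2 := by positivity
  have : w 0 ^ 2 * y 0 ^ 2 ≤ (w 1 ^ 2 + w 2 ^ 2 + w 3 ^ 2) * y 0 ^ 2 := by nlinarith
  have := le_of_mul_le_mul_right this hy2
  linarith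

theorem neg_lorentz_le {x y z : L4} (hx : x ∈ H3) (hy : y ∈ H3) (hz : z ∈ H3) :
    -lorentz x z ≤ (-lorentz x y - lorentz y z) ^ 2 := by
  have h := lorentz_nonneg_of_orthogonal (w := x + z + (lorentz x y + lorentz y z) • y) hy (by
    have h1 := hy.1
    simp only [lorentz, Pi.add_apply, Pi.smul_apply, smul_eq_mul] at *
    linear_combination (-(x 0 * y 0) + x 1 * y 1 + x 2 * y 2 + x 3 * y 3
      + (-(y 0 * z 0) + y 1 * z 1 + y 2 * z 2 + y 3 * z 3)) * h1)
  have e : lorentz (x + z + (lorentz x y + lorentz y z) • y)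
      (x + z + (lorentz x y + lorentz y z) • y)
      = -2 + 2 * lorentz x z + (lorentz x y + lorentz y z) ^ 2 := by
    have h1 := hy.1
    have h2 := hx.1
    have h3 := hz.1
    simp only [lorentz, Pi.add_apply, Pi.smul_apply, smul_eq_mul] at *
    linear_combination (-(x 0 * y 0) + x 1 * y 1 + x 2 * y 2 + x 3 * y 3
      + (-(y 0 * z 0) + y 1 * z 1 + y 2 * z 2 + y 3 * z 3)) ^ 2 * h1 + h2 + h3
  rw [e] at h
  nlinarith [sq_nonneg (lorentz x y + lorentz y z)]

theorem one_le_neg_lorentz {x y : L4} (hx : x ∈ H3) (hy : y ∈ H3) : 1 ≤ -lorentz x y := by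
  have h := lorentz_nonneg_of_orthogonal (w := x + lorentz x y • y) hy (by
    have h1 := hy.1
    simp only [lorentz, Pi.add_apply, Pi.smul_apply, smul_eq_mul] at *
    linear_combination (-(x 0 * y 0) + x 1 * y 1 + x 2 * y 2 + x 3 * y 3) * h1)
  have e : lorentz (x + lorentz x y • y) (x + lorentz x y • y) = -1 + lorentz x y ^ 2 := by
    have h1 := hy.1
    have h2 := hx.1
    simp only [lorentz, Pi.add_apply, Pi.smul_apply, smul_eq_mul] at *
    linear_combination (-(x 0 * y 0) + x 1 * y 1 + x 2 * y 2 + x 3 * y 3) ^ 2 * h1 + h2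
  rw [e] at h
  have hneg : lorentz x y < 0 := by
    obtain ⟨hx1, hx0⟩ := hx
    obtain ⟨hy1, hy0⟩ := hy
    simp only [lorentz] at hx1 hy1 ⊢
    have hcs : (x 1 * y 1 + x 2 * y 2 + x 3 * y 3) ^ 2
        ≤ (x 1 ^ 2 + x 2 ^ 2 + x 3 ^ 2) * (y 1 ^ 2 + y 2 ^ 2 + y 3 ^ 2) := by
      nlinarith [sq_nonneg (x 1 * y 2 - x 2 * y 1), sq_nonneg (x 1 * y 3 - x 3 * y 1),
        sq_nonneg (x 2 * y 3 - x 3 * y 2)]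
    have e1 : x 1 ^ 2 + x 2 ^ 2 + x 3 ^ 2 = x 0 ^ 2 - 1 := by linarith
    have e2 : y 1 ^ 2 + y 2 ^ 2 + y 3 ^ 2 = y 0 ^ 2 - 1 := by linarith
    rw [e1, e2] at hcs
    have p1 : 0 ≤ x 0 ^ 2 - 1 := by rw [← e1]; positivity
    have p2 : 0 ≤ y 0 ^ 2 - 1 := by rw [← e2]; positivity
    have hlt : (x 1 * y 1 + x 2 * y 2 + x 3 * y 3) ^ 2 < (x 0 * y 0) ^ 2 := by
      rw [mul_pow]; nlinarith
    have := abs_lt_of_sq_lt_sq hlt (by positivity)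
    linarith [(abs_lt.mp this).2]
  nlinarith

/-- For curves in hyperbolic space, boundedness of the distance is boundedness of its `cosh`. -/
theorem asymptotic_iff (g h : UH3) :
    Asymptotic g.curve h.curve ↔ ∃ C : ℝ, ∀ t > 0, -lorentz (g.curve t) (h.curve t) ≤ C := by
  constructor
  · rintro ⟨B, hB⟩
    refine ⟨Real.cosh B, fun t ht => ?_⟩
    have h1 := one_le_neg_lorentz (g.curve_mem t) (h.curve_mem t)
    have h2 : hypDist (g.curve t) (h.curve t) ≤ B := hB ⟨t, ht, rfl⟩
    have h0 : 0 ≤ hypDist (g.curve t) (h.curve t) := Real.arcosh_nonneg h1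
    rw [← Real.cosh_arcosh h1, Real.cosh_le_cosh]
    change |hypDist (g.curve t) (h.curve t)| ≤ |B|
    rw [abs_of_nonneg h0]
    exact h2.trans (le_abs_self B)
  · rintro ⟨C, hC⟩
    refine ⟨Real.arcosh C, ?_⟩
    rintro _ ⟨t, ht, rfl⟩
    have h1 := one_le_neg_lorentz (g.curve_mem t) (h.curve_mem t)
    have h2 := hC t ht
    exact (Real.arcosh_le_arcosh (by linarith) (by linarith)).2 h2

/-- Being asymptotic is an equivalence relation on unit speed geodesics. -/
instance asymptoticSetoid : Setoid UH3 where
  r g h := Asymptotic g.curve h.curve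
  iseqv :=
    { refl := fun g => (asymptotic_iff g g).2 ⟨1, fun t _ => by
        rw [(g.curve_mem t).1]; norm_num⟩
      symm := fun {g h} H => by
        obtain ⟨C, hC⟩ := (asymptotic_iff g h).1 H
        exact (asymptotic_iff h g).2 ⟨C, fun t ht => by rw [lorentz_comm]; exact hC t ht⟩
      trans := fun {g h k} H K => by
        obtain ⟨C, hC⟩ := (asymptotic_iff g h).1 H
        obtain ⟨D, hD⟩ := (asymptotic_iff h k).1 K
        refine (asymptotic_iff g k).2 ⟨(C + D) ^ 2, fun t ht => ?_⟩
        have h1 := neg_lorentz_le (g.curve_mem t) (h.curve_mem t) (k.curve_mem t)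
        have h2 := one_le_neg_lorentz (g.curve_mem t) (h.curve_mem t)
        have h3 := one_le_neg_lorentz (h.curve_mem t) (k.curve_mem t)
        have h4 := hC t ht
        have h5 := hD t ht
        refine h1.trans (pow_le_pow_left₀ (by linarith) (by linarith) 2) }

/-- The ideal boundary of hyperbolic space: asymptotic classes of unit speed geodesics. -/
def IdealBoundary : Type := Quotient asymptoticSetoid

/-- The end point at `t → +∞` of a unit speed geodesic. -/
def UH3.endpoint (g : UH3) : IdealBoundary := Quotient.mk asymptoticSetoid g

/-! ### Surfaces in hyperbolic 3-space -/

section Surfaces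

variable {M : Type*} [TopologicalSpace M] [ChartedSpace (EuclideanSpace ℝ (Fin 2)) M]

/-- The differential of an `L4`-valued map. -/
def diff (f : M → L4) (p : M) : TangentSpace (𝓡 2) p →L[ℝ] L4 :=
  mfderiv (𝓡 2) 𝓘(ℝ, L4) f p

/-- A surface of class `C^n` in hyperbolic space: an immersion of the `2`-manifold `M`. -/
structure IsSurface (n : WithTop ℕ∞) (f : M → L4) : Prop where
  contMDiff : ContMDiff (𝓡 2) 𝓘(ℝ, L4) n f
  mem_H3 : ∀ p, f p ∈ H3
  injective_diff : ∀ p, Function.Injective (diff f p)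

/-- The first fundamental form. -/
def firstForm (f : M → L4) (p : M) (v w : TangentSpace (𝓡 2) p) : ℝ :=
  lorentz (diff f p v) (diff f p w)

/-- The Riemannian distance of the first fundamental form: the infimum of the lengths of `C¹` paths,
the length of a tangent vector `v` being `√g(v, v)`. -/
def inducedEDist (f : M → L4) (p q : M) : ℝ≥0∞ :=
  letI : ∀ x : M, ENorm (TangentSpace (𝓡 2) x) :=
    fun x => ⟨fun v => ENNReal.ofReal (Real.sqrt (firstForm f x v v))⟩
  Manifold.riemannianEDist (𝓡 2) p q

/-- The surface `f` is complete: every Cauchy sequence for the induced distance converges. -/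
def IsCompleteSurface (f : M → L4) : Prop :=
  ∀ u : ℕ → M, (∀ ε : ℝ≥0∞, 0 < ε → ∃ N, ∀ m ≥ N, ∀ n ≥ N, inducedEDist f (u m) (u n) < ε) →
    ∃ p : M, Filter.Tendsto u Filter.atTop (𝓝 p)

/-- `ν` is a (smooth) unit normal vector field of `f` on the open set `U`. -/
structure IsUnitNormal (f : M → L4) (U : Set M) (ν : M → L4) : Prop where
  isOpen : IsOpen U
  contMDiffOn : ContMDiffOn (𝓡 2) 𝓘(ℝ, L4) ∞ ν U
  tangent_H3 : ∀ p ∈ U, lorentz (f p) (ν p) = 0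
  unit : ∀ p ∈ U, lorentz (ν p) (ν p) = 1
  normal : ∀ p ∈ U, ∀ w, lorentz (ν p) (diff f p w) = 0

/-- The second fundamental form `II(v, w) = -⟨ν_* v, f_* w⟩`. -/
def secondForm (f ν : M → L4) (p : M) (v w : TangentSpace (𝓡 2) p) : ℝ :=
  -lorentz (diff ν p v) (diff f p w)

/-- The shape operator `A = -(f_*)⁻¹ ∘ ν_*` (for an immersion `f` with unit normal field `ν`,
the image of `ν_*` lies in the image of `f_*`). -/
def shapeOperator (f ν : M → L4) (p : M) : TangentSpace (𝓡 2) p →ₗ[ℝ] TangentSpace (𝓡 2) p :=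
  -((diff f p).toLinearMap.leftInverse ∘ₗ (diff ν p).toLinearMap)

/-- The extrinsic curvature, the product of the principal curvatures. -/
def extrinsicCurvature (f ν : M → L4) (p : M) : ℝ := LinearMap.det (shapeOperator f ν p)

/-- The mean curvature, half the sum of the principal curvatures. -/
def meanCurvature (f ν : M → L4) (p : M) : ℝ :=
  LinearMap.trace ℝ (TangentSpace (𝓡 2) p) (shapeOperator f ν p) / 2

/-- Extrinsically flat surfaces. The surface need not be orientable, so local unit normal fields
are used; the extrinsic curvature does not depend on the choice. -/
def IsExtrinsicallyFlat (f : M → L4) : Prop :=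
  ∀ (U : Set M) (ν : M → L4), IsUnitNormal f U ν → ∀ p ∈ U, extrinsicCurvature f ν p = 0

/-- Umbilic points: the principal curvatures coincide. -/
def IsUmbilic (f : M → L4) (p : M) : Prop :=
  ∃ (U : Set M) (ν : M → L4), IsUnitNormal f U ν ∧ p ∈ U ∧
    ∃ k : ℝ, shapeOperator f ν p = k • LinearMap.id

/-- A local coordinate system `φ = (s, t)` and curves `c`, `v` such that `v` is a unit normal vector
field along the curve `c` in hyperbolic space and `f ∘ φ⁻¹ (s, t) = cosh t • c s + sinh t • v s`. -/
structure IsRuledChart (f : M → L4) (φ : OpenPartialHomeomorph M (EuclideanSpace ℝ (Fin 2)))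
    (c v : ℝ → L4) : Prop where
  mem_atlas : φ ∈ IsManifold.maximalAtlas (𝓡 2) ∞ M
  contDiffAt_curve : ∀ x ∈ φ.target, ContDiffAt ℝ ∞ c (x 0)
  contDiffAt_field : ∀ x ∈ φ.target, ContDiffAt ℝ ∞ v (x 0)
  isUnitTangent : ∀ x ∈ φ.target, IsUnitTangent (c (x 0)) (v (x 0))
  normal : ∀ x ∈ φ.target, lorentz (deriv c (x 0)) (v (x 0)) = 0
  eq_geod : ∀ x ∈ φ.target, f (φ.symm x) = geod (c (x 0)) (v (x 0)) (x 1)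

/-- Ruled surfaces: around each point there is a ruled coordinate system. -/
def IsRuled (f : M → L4) : Prop :=
  ∀ p : M, ∃ φ c v, IsRuledChart f φ c v ∧ p ∈ φ.source

/-- Developable surfaces: ruled and extrinsically flat. -/
def IsDevelopable (f : M → L4) : Prop := IsRuled f ∧ IsExtrinsicallyFlat f

/-- The velocity vector of a curve in `M`. -/
def velocity (γ : ℝ → M) (t : ℝ) : TangentSpace (𝓡 2) (γ t) :=
  mfderiv 𝓘(ℝ, ℝ) (𝓡 2) γ t (1 : ℝ)

/-- `γ`, restricted to the open interval `I`, is an asymptotic curve of `f` in the set of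
non-umbilic points, parametrized by arc length: its velocity spans the kernel of the second
fundamental form. -/
structure IsAsymptoticCurve (f : M → L4) (I : Set ℝ) (γ : ℝ → M) : Prop where
  isOpen : IsOpen I
  ordConnected : I.OrdConnected
  contMDiffOn : ContMDiffOn 𝓘(ℝ, ℝ) (𝓡 2) ∞ γ I
  arcLength : ∀ t ∈ I, firstForm f (γ t) (velocity γ t) (velocity γ t) = 1
  not_umbilic : ∀ t ∈ I, ¬ IsUmbilic f (γ t)
  kernel : ∀ (U : Set M) (ν : M → L4), IsUnitNormal f U ν → ∀ t ∈ I, γ t ∈ U →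
    ∀ v : TangentSpace (𝓡 2) (γ t),
      (∀ w, secondForm f ν (γ t) v w = 0) ↔ ∃ r : ℝ, v = r • velocity γ t

/-- Complete developable surfaces of exponential type: not totally umbilic, and the mean curvature
is proportional to `e^t` or to `e^{-t}` on each asymptotic curve in the non-umbilic set, where `t`
is the arc length. (As a non-orientable surface has no global unit normal field, this is said for
the local ones, and for curves in their domain.) -/
structure IsExponentialType (f : M → L4) : Prop where
  complete : IsCompleteSurface f
  developable : IsDevelopable f
  not_totally_umbilic : ∃ p, ¬ IsUmbilic f p
  exponential : ∀ (U : Set M) (ν : M → L4), IsUnitNormal f U ν →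
    ∀ (I : Set ℝ) (γ : ℝ → M), IsAsymptoticCurve f I γ → (∀ t ∈ I, γ t ∈ U) →
      ∃ C : ℝ, (∀ t ∈ I, meanCurvature f ν (γ t) = C * Real.exp t) ∨
        (∀ t ∈ I, meanCurvature f ν (γ t) = C * Real.exp (-t))

/-- Ideal cones: complete developable surfaces that are the locus of a one-parameter family of
geodesics sharing one end `ξ` (the vertex) in the ideal boundary. The geodesics are the `t`-lines of
ruled coordinates, and through each point of the surface the whole geodesic stays in it. -/
structure IsIdealCone (f : M → L4) : Prop where
  complete : IsCompleteSurface f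
  developable : IsDevelopable f
  vertex : ∃ ξ : IdealBoundary,
    (∀ p : M, ∃ φ c v, IsRuledChart f φ c v ∧ p ∈ φ.source ∧
      ∀ x ∈ φ.target, ∃ h : IsUnitTangent (c (x 0)) (v (x 0)),
        UH3.endpoint ⟨(c (x 0), v (x 0)), h⟩ = ξ) ∧
    (∀ p : M, ∃ (γ : ℝ → M) (g : UH3), Continuous γ ∧ γ 0 = p ∧ (∀ t, f (γ t) = g.curve t) ∧
      g.endpoint = ξ)

end Surfaces

end HypSurf

end

/-! # The vertex of a developable surface of exponential type

In ruled coordinates write `f = cosh t • c + sinh t • v` and let `ν` be a unit normal field.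
Extrinsic flatness forces `∂ν/∂t = 0` and `∂ν/∂s = -2H ∂f/∂s`, where `H` is the mean curvature
(`IsRuledChart.normalDeriv_one`, `IsRuledChart.exists_normalDeriv_zero_eq`,
`IsRuledChart.meanCurvature_eq`). As the left side of the second equation does not depend on `t`,
the curve `t ↦ H • (cosh t • c' + sinh t • v')` is constant. At a non-umbilic point `H` is a nonzero
multiple of `e^t` or of `e^{-t}`, so `c' + v' = 0` or `c' - v' = 0`. Since `c'` and `v'` do not both
vanish, one choice of the sign is good for a whole neighbourhood, and there the null vector
`N = c ± v`, that is, the ideal end point of the rulings, is constant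
(`IsRuledChart.exists_isFutureNull`).

In the light cone picture, `N` lies in the linear span of `f` and the tangent plane, which means
`⟨N, ν⟩ = 0`. In any chart of the analytic atlas this is the vanishing of an analytic function, so
it propagates from this one neighbourhood over the connected surface
(`forall_lorentz_normal_eq_zero`). For the same reason the non-umbilic points are dense
(`isUmbilic_of_eventually_diff_eq_zero`). Differentiating `⟨N, ν⟩ = 0` along `s` at a non-umbilic
point gives `⟨N, ∂f/∂s⟩ = 0`, and by density this holds everywhere. Hence `N` is in the span of `f`
and `∂f/∂t` at each point: all rulings run to `N` or away from it
(`IsRuledChart.ruledT_eq_toward`). The exponential growth of `H` is used at a single non-umbilic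
point only.

It remains to see that whole geodesics lie in the surface. A geodesic of hyperbolic space that runs
to `N` lifts locally to the surface along a ruling; lifts are unique because `f` is locally
injective, and completeness lets a lift be continued past the end of any bounded interval
(`exists_isLift_extension`). Finally, asymptotic curves are tangent to the kernel of the second
fundamental form, which is the direction of the rulings, so they are, up to orientation, geodesics
that end at `N` (`IsAsymptoticCurve.exists_eq_geod`), and two such geodesics are asymptotic
(`asymptotic_of_add_eq_smul`).
-/

noncomputable section

namespace HypSurf

/-! ### Linear algebra of the Lorentz metric -/

theorem lorentz_add_left (x y z : L4) : lorentz (x + y) z = lorentz x z + lorentz y z := by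
  simp only [lorentz, Pi.add_apply]; ring

theorem lorentz_add_right (x y z : L4) : lorentz x (y + z) = lorentz x y + lorentz x z := by
  simp only [lorentz, Pi.add_apply]; ring

theorem lorentz_sub_left (x y z : L4) : lorentz (x - y) z = lorentz x z - lorentz y z := by
  simp only [lorentz, Pi.sub_apply]; ring

theorem lorentz_sub_right (x y z : L4) : lorentz x (y - z) = lorentz x y - lorentz x z := by
  simp only [lorentz, Pi.sub_apply]; ring

theorem lorentz_smul_left (r : ℝ) (x y : L4) : lorentz (r • x) y = r * lorentz x y := by
  simp only [lorentz, Pi.smul_apply, smul_eq_mul]; ring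

theorem lorentz_smul_right (r : ℝ) (x y : L4) : lorentz x (r • y) = r * lorentz x y := by
  simp only [lorentz, Pi.smul_apply, smul_eq_mul]; ring

theorem lorentz_neg_left (x y : L4) : lorentz (-x) y = -lorentz x y := by
  simp only [lorentz, Pi.neg_apply]; ring

theorem lorentz_neg_right (x y : L4) : lorentz x (-y) = -lorentz x y := by
  simp only [lorentz, Pi.neg_apply]; ring

theorem lorentz_zero_left (y : L4) : lorentz 0 y = 0 := by simp [lorentz]

theorem lorentz_zero_right (y : L4) : lorentz y 0 = 0 := by simp [lorentz]

theorem eq_zero_of_forall_lorentz {x : L4} (h : ∀ y, lorentz x y = 0) : x = 0 := by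
  have h' (i : Fin 4) := h (Pi.single i 1)
  simp only [lorentz, Fin.forall_fin_succ, Fin.isValue] at h'
  ext i
  fin_cases i <;> simp_all [Pi.single_apply]

theorem _root_.HasDerivAt.lorentz {a b : ℝ → L4} {a' b' : L4} {t : ℝ} (ha : HasDerivAt a a' t)
    (hb : HasDerivAt b b' t) :
    HasDerivAt (fun r => lorentz (a r) (b r)) (lorentz a' (b t) + lorentz (a t) b') t := by
  have ha' (i) := hasDerivAt_pi.1 ha i
  have hb' (i) := hasDerivAt_pi.1 hb i
  have := ((((ha' 0).mul (hb' 0)).neg.add ((ha' 1).mul (hb' 1))).add ((ha' 2).mul (hb' 2))).add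
    ((ha' 3).mul (hb' 3))
  refine this.congr_deriv ?_
  simp only [HypSurf.lorentz]; ring

theorem _root_.ContDiffAt.lorentz {E : Type*} [NormedAddCommGroup E] [NormedSpace ℝ E]
    {n : WithTop ℕ∞} {a b : E → L4} {x : E}
    (ha : ContDiffAt ℝ n a x) (hb : ContDiffAt ℝ n b x) :
    ContDiffAt ℝ n (fun r => lorentz (a r) (b r)) x := by
  have ha' (i) := contDiffAt_pi.1 ha i
  have hb' (i) := contDiffAt_pi.1 hb i
  exact ((((ha' 0).mul (hb' 0)).neg.add ((ha' 1).mul (hb' 1))).add ((ha' 2).mul (hb' 2))).add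
    ((ha' 3).mul (hb' 3))

theorem continuous_lorentz : Continuous fun p : L4 × L4 => lorentz p.1 p.2 := by
  unfold lorentz; fun_prop

/-- A timelike unit vector `a`, the image of an injective linear map `T` from a plane and a unit
vector `w`, mutually orthogonal, span `L4`; the components along `a` and `w` are read off from the
Lorentz products. -/
theorem exists_frame_decomposition {V : Type*} [AddCommGroup V] [Module ℝ V]
    (hV : Module.finrank ℝ V = 2) {a w : L4} {T : V →ₗ[ℝ] L4} (hT : Function.Injective T)
    (ha : lorentz a a = -1) (haT : ∀ v, lorentz a (T v) = 0) (haw : lorentz a w = 0)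
    (hw : lorentz w w = 1) (hwT : ∀ v, lorentz w (T v) = 0) (x : L4) :
    ∃ v, x = -lorentz x a • a + T v + lorentz x w • w := by
  have : FiniteDimensional ℝ V := Module.finite_of_finrank_pos (by omega)
  let S : (ℝ × ℝ) × V →ₗ[ℝ] L4 :=
    (((LinearMap.toSpanSingleton ℝ L4 a).coprod (LinearMap.toSpanSingleton ℝ L4 w)).coprod T)
  have hS (r s : ℝ) (v : V) : S ((r, s), v) = r • a + s • w + T v := by simp [S]
  have e1 (r s : ℝ) (v : V) : lorentz (S ((r, s), v)) a = -r := by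
    rw [hS, lorentz_add_left, lorentz_add_left, lorentz_smul_left, lorentz_smul_left,
      lorentz_comm w, lorentz_comm (T v), ha, haw, haT]; ring
  have e2 (r s : ℝ) (v : V) : lorentz (S ((r, s), v)) w = s := by
    rw [hS, lorentz_add_left, lorentz_add_left, lorentz_smul_left, lorentz_smul_left,
      lorentz_comm (T v), hw, haw, hwT]; ring
  have hinj : Function.Injective S := by
    rw [injective_iff_map_eq_zero]
    rintro ⟨⟨r, s⟩, v⟩ h
    have h1 := e1 r s v
    have h2 := e2 r s v
    rw [h, lorentz_zero_left] at h1 h2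
    have hr : r = 0 := by linarith
    subst hr; subst h2
    rw [hS] at h
    have : T v = T 0 := by simpa using h
    rw [hT this]; rfl
  have hsurj : Function.Surjective S := by
    refine (LinearMap.injective_iff_surjective_of_finrank_eq_finrank ?_).1 hinj
    simp [hV]
  obtain ⟨⟨⟨r, s⟩, v⟩, rfl⟩ := hsurj x
  refine ⟨v, ?_⟩
  rw [e1, e2, hS]; module

section Frame

variable {V : Type*} [AddCommGroup V] [Module ℝ V]

/-- A point `a` of hyperbolic space, a tangent plane at it (the image of `T`) and a unit normal `w`
of this plane. -/
structure IsFrame (a : L4) (T : V →ₗ[ℝ] L4) (w : L4) : Prop where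
  finrank : Module.finrank ℝ V = 2
  injective : Function.Injective T
  mem_H3 : a ∈ H3
  point_tangent : ∀ v, lorentz a (T v) = 0
  point_normal : lorentz a w = 0
  unit : lorentz w w = 1
  normal_tangent : ∀ v, lorentz w (T v) = 0

variable {a w : L4} {T : V →ₗ[ℝ] L4}

theorem IsFrame.exists_eq (h : IsFrame a T w) (x : L4) :
    ∃ v, x = -lorentz x a • a + T v + lorentz x w • w :=
  exists_frame_decomposition h.finrank h.injective h.mem_H3.1 h.point_tangent h.point_normal h.unit
    h.normal_tangent x

theorem IsFrame.eq_zero (h : IsFrame a T w) {x : L4} (hxa : lorentz x a = 0)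
    (hxT : ∀ v, lorentz x (T v) = 0) (hxw : lorentz x w = 0) : x = 0 := by
  refine eq_zero_of_forall_lorentz fun y => ?_
  obtain ⟨v, hv⟩ := h.exists_eq y
  rw [hv, lorentz_add_right, lorentz_add_right, lorentz_smul_right, lorentz_smul_right, hxa, hxT,
    hxw]
  ring

theorem IsFrame.exists_tangent (h : IsFrame a T w) {x : L4} (hxa : lorentz x a = 0)
    (hxw : lorentz x w = 0) : ∃ v, T v = x := by
  obtain ⟨v, hv⟩ := h.exists_eq x
  rw [hxa, hxw] at hv
  exact ⟨v, by rw [hv]; module⟩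

theorem IsFrame.eq_smul_normal (h : IsFrame a T w) {x : L4} (hxa : lorentz x a = 0)
    (hxT : ∀ v, lorentz x (T v) = 0) : x = lorentz x w • w := by
  rw [← sub_eq_zero]
  refine h.eq_zero ?_ (fun v => ?_) ?_
  · rw [lorentz_sub_left, lorentz_smul_left, lorentz_comm w, h.point_normal, hxa]; ring
  · rw [lorentz_sub_left, lorentz_smul_left, h.normal_tangent, hxT]; ring
  · rw [lorentz_sub_left, lorentz_smul_left, h.unit]; ring

theorem IsFrame.eq_or_eq_neg (h : IsFrame a T w) {x : L4} (hxa : lorentz x a = 0)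
    (hxT : ∀ v, lorentz x (T v) = 0) (hx : lorentz x x = 1) : x = w ∨ x = -w := by
  have e := h.eq_smul_normal hxa hxT
  have : lorentz x w * lorentz x w = 1 := by
    rw [e, lorentz_smul_left, lorentz_smul_right, h.unit] at hx
    linarith
  rcases mul_self_eq_one_iff.1 this with h1 | h1
  · left; rw [e, h1, one_smul]
  · right; rw [e, h1, neg_one_smul]

end Frame

/-- The cross product of three vectors of `L4`: it is Lorentz orthogonal to each of them. -/
def cross (x y z : L4) : L4 :=
  ![(x 1 * (y 2 * z 3 - y 3 * z 2) - x 2 * (y 1 * z 3 - y 3 * z 1) + x 3 * (y 1 * z 2 - y 2 * z 1)),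
    (x 0 * (y 2 * z 3 - y 3 * z 2) - x 2 * (y 0 * z 3 - y 3 * z 0) + x 3 * (y 0 * z 2 - y 2 * z 0)),
    (x 1 * (y 0 * z 3 - y 3 * z 0) - x 0 * (y 1 * z 3 - y 3 * z 1) - x 3 * (y 0 * z 1 - y 1 * z 0)),
    (x 0 * (y 1 * z 2 - y 2 * z 1) - x 1 * (y 0 * z 2 - y 2 * z 0) + x 2 * (y 0 * z 1 - y 1 * z 0))]

theorem lorentz_cross_first (x y z : L4) : lorentz (cross x y z) x = 0 := by
  simp [lorentz, cross]; ring

theorem lorentz_cross_second (x y z : L4) : lorentz (cross x y z) y = 0 := by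
  simp [lorentz, cross]; ring

theorem lorentz_cross_third (x y z : L4) : lorentz (cross x y z) z = 0 := by
  simp [lorentz, cross]; ring

theorem lorentz_cross_self (x y z : L4) : lorentz (cross x y z) (cross x y z) =
    -(lorentz x x * (lorentz y y * lorentz z z - lorentz y z ^ 2)
      - lorentz x y * (lorentz x y * lorentz z z - lorentz y z * lorentz x z)
      + lorentz x z * (lorentz x y * lorentz y z - lorentz y y * lorentz x z)) := by
  simp [lorentz, cross]; ring

/-- Nonzero tangent vectors of hyperbolic space are spacelike. -/
theorem lorentz_self_pos {y w : L4} (hy : y ∈ H3) (h : lorentz w y = 0) (hw : w ≠ 0) :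
    0 < lorentz w w := by
  refine lt_of_le_of_ne (lorentz_nonneg_of_orthogonal hy h) fun h0 => hw ?_
  -- by polarization, a null vector orthogonal to `y` is orthogonal to the whole space
  have key (z : L4) (hz : lorentz z y = 0) : lorentz w z = 0 := by
    by_contra hne
    have hzz := lorentz_nonneg_of_orthogonal hy hz
    have := lorentz_nonneg_of_orthogonal (w := z + (-(lorentz z z + 1) / (2 * lorentz w z)) • w) hy
      (by rw [lorentz_add_left, lorentz_smul_left, h, hz]; ring)
    rw [lorentz_add_left, lorentz_add_right, lorentz_add_right, lorentz_smul_left,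
      lorentz_smul_right, lorentz_smul_right, lorentz_smul_left, ← h0, lorentz_comm z w] at this
    have e : -(lorentz z z + 1) / (2 * lorentz w z) * lorentz w z = -(lorentz z z + 1) / 2 := by
      field_simp
    rw [e] at this
    linarith
  refine eq_zero_of_forall_lorentz fun z => ?_
  have := key (z + lorentz z y • y) (by rw [lorentz_add_left, lorentz_smul_left, hy.1]; ring)
  rwa [lorentz_add_right, lorentz_smul_right, h, mul_zero, add_zero] at this

/-- The cross product of a point of hyperbolic space with a basis of a tangent plane is spacelike,
by the Gram determinant `lorentz_cross_self`. -/
theorem lorentz_cross_self_pos {a b c : L4} (ha : a ∈ H3) (hb : lorentz a b = 0)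
    (hc : lorentz a c = 0) (hbc : LinearIndependent ℝ ![b, c]) :
    0 < lorentz (cross a b c) (cross a b c) := by
  have hb0 : b ≠ 0 := hbc.ne_zero 0
  have hbb := lorentz_self_pos ha (by rwa [lorentz_comm] : lorentz b a = 0) hb0
  have hd : c - (lorentz b c / lorentz b b) • b ≠ 0 := by
    intro h
    have := LinearIndependent.pair_iff.1 hbc (-(lorentz b c / lorentz b b)) 1 (by rw [← h]; module)
    exact one_ne_zero this.2
  have hpos := lorentz_self_pos ha (by
    rw [lorentz_sub_left, lorentz_smul_left, lorentz_comm c a, lorentz_comm b a, hb, hc]; ring) hd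
  rw [lorentz_cross_self, ha.1, hb, hc]
  have e : lorentz (c - (lorentz b c / lorentz b b) • b) (c - (lorentz b c / lorentz b b) • b)
      = lorentz c c - lorentz b c ^ 2 / lorentz b b := by
    rw [lorentz_sub_left, lorentz_sub_right, lorentz_sub_right, lorentz_smul_left,
      lorentz_smul_right, lorentz_smul_right, lorentz_smul_left, lorentz_comm c b]
    field_simp; ring
  rw [e, lt_sub_iff_add_lt, zero_add, div_lt_iff₀ hbb] at hpos
  nlinarith

theorem _root_.ContDiffAt.cross {E : Type*} [NormedAddCommGroup E] [NormedSpace ℝ E]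
    {n : WithTop ℕ∞} {a b c : E → L4} {x : E} (ha : ContDiffAt ℝ n a x) (hb : ContDiffAt ℝ n b x)
    (hc : ContDiffAt ℝ n c x) : ContDiffAt ℝ n (fun r => cross (a r) (b r) (c r)) x := by
  have ha' (i) := contDiffAt_pi.1 ha i
  have hb' (i) := contDiffAt_pi.1 hb i
  have hc' (i) := contDiffAt_pi.1 hc i
  refine contDiffAt_pi.2 fun i => ?_
  fin_cases i <;> simp only [HypSurf.cross] <;> simp <;> fun_prop

/-! ### Geodesics ending at a point of the light cone -/

/-- A future-directed null vector; its ray stands for a point of the ideal boundary. -/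
def IsFutureNull (N : L4) : Prop := lorentz N N = 0 ∧ 0 < N 0

theorem IsFutureNull.lorentz_neg {N y : L4} (hN : IsFutureNull N) (hy : y ∈ H3) :
    lorentz N y < 0 := by
  obtain ⟨h1, h0⟩ := hN
  obtain ⟨g1, g0⟩ := hy
  simp only [lorentz] at *
  have hcs : (N 1 * y 1 + N 2 * y 2 + N 3 * y 3) ^ 2
      ≤ (N 1 ^ 2 + N 2 ^ 2 + N 3 ^ 2) * (y 1 ^ 2 + y 2 ^ 2 + y 3 ^ 2) := by
    nlinarith [sq_nonneg (N 1 * y 2 - N 2 * y 1), sq_nonneg (N 1 * y 3 - N 3 * y 1),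
      sq_nonneg (N 2 * y 3 - N 3 * y 2)]
  have e1 : N 1 ^ 2 + N 2 ^ 2 + N 3 ^ 2 = N 0 ^ 2 := by linarith
  have e2 : y 1 ^ 2 + y 2 ^ 2 + y 3 ^ 2 = y 0 ^ 2 - 1 := by linarith
  rw [e1, e2] at hcs
  have hlt : (N 1 * y 1 + N 2 * y 2 + N 3 * y 3) ^ 2 < (N 0 * y 0) ^ 2 := by
    have : 0 < N 0 ^ 2 := by positivity
    nlinarith
  have := abs_lt_of_sq_lt_sq hlt (by positivity)
  linarith [(abs_lt.mp this).2]

theorem IsUnitTangent.neg {p v : L4} (h : IsUnitTangent p v) : IsUnitTangent p (-v) :=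
  ⟨h.1, by rw [lorentz_neg_right, h.2.1, neg_zero],
    by rw [lorentz_neg_left, lorentz_neg_right, h.2.2, neg_neg]⟩

theorem IsUnitTangent.isFutureNull {p v : L4} (h : IsUnitTangent p v) :
    IsFutureNull (p + v) := by
  have hn : lorentz (p + v) (p + v) = 0 := by
    rw [lorentz_add_left, lorentz_add_right, lorentz_add_right, lorentz_comm v, h.1.1, h.2.1, h.2.2]
    ring
  refine ⟨hn, ?_⟩
  obtain ⟨⟨hp, hp0⟩, hpv, hv⟩ := h
  simp only [lorentz, Pi.add_apply] at *
  have hpv2 : (p 0 * v 0) ^ 2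
      ≤ (p 1 ^ 2 + p 2 ^ 2 + p 3 ^ 2) * (v 1 ^ 2 + v 2 ^ 2 + v 3 ^ 2) := by
    have : p 0 * v 0 = p 1 * v 1 + p 2 * v 2 + p 3 * v 3 := by linarith
    rw [this]
    nlinarith [sq_nonneg (p 1 * v 2 - p 2 * v 1), sq_nonneg (p 1 * v 3 - p 3 * v 1),
      sq_nonneg (p 2 * v 3 - p 3 * v 2)]
  have e1 : p 1 ^ 2 + p 2 ^ 2 + p 3 ^ 2 = p 0 ^ 2 - 1 := by linarith
  have e2 : v 1 ^ 2 + v 2 ^ 2 + v 3 ^ 2 = v 0 ^ 2 + 1 := by linarith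
  rw [e1, e2] at hpv2
  have hv0 : v 0 ^ 2 < p 0 ^ 2 := by nlinarith
  have := abs_lt_of_sq_lt_sq hv0 hp0.le
  linarith [(abs_lt.mp this).1]

/-- The unit tangent vector at `y` of the geodesic that starts at `y` and ends at the null
direction `N`. -/
def toward (N y : L4) : L4 := (-lorentz N y)⁻¹ • N - y

theorem add_toward (N y : L4) : y + toward N y = (-lorentz N y)⁻¹ • N := by simp [toward]

theorem IsFutureNull.isUnitTangent_toward {N y : L4} (hN : IsFutureNull N) (hy : y ∈ H3) :
    IsUnitTangent y (toward N y) := by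
  have h := hN.lorentz_neg hy
  have hne : lorentz N y ≠ 0 := h.ne
  refine ⟨hy, ?_, ?_⟩
  · rw [toward, lorentz_sub_right, lorentz_smul_right, lorentz_comm y N, hy.1]
    field_simp; ring
  · rw [toward, lorentz_sub_left, lorentz_sub_right, lorentz_sub_right, lorentz_smul_left,
      lorentz_smul_right, lorentz_smul_right, lorentz_smul_left, lorentz_comm y N, hy.1, hN.1]
    field_simp; ring

/-- The unit tangent vector `w` at `y` points to `N` when `y + w` is on the ray of `N`. -/
theorem eq_toward {N y w : L4} (h : IsUnitTangent y w) {r : ℝ} (hr : y + w = r • N) :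
    w = toward N y := by
  have e : lorentz (y + w) y = -1 := by
    rw [lorentz_add_left, lorentz_comm w, h.1.1, h.2.1]; ring
  rw [hr, lorentz_smul_left] at e
  have hN : lorentz N y ≠ 0 := by rintro h0; rw [h0] at e; norm_num at e
  have hr' : r = (-lorentz N y)⁻¹ := by field_simp; linarith
  rw [toward, ← hr', ← hr]; module

theorem geod_add (p v : L4) (t s : ℝ) :
    geod p v (t + s) = geod (geod p v t) (Real.sinh t • p + Real.cosh t • v) s := by
  simp only [geod, Real.cosh_add, Real.sinh_add]; module

theorem geod_neg (p v : L4) (t : ℝ) : geod p (-v) t = geod p v (-t) := by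
  simp [geod]

theorem geod_mem {p v : L4} (h : IsUnitTangent p v) (t : ℝ) : geod p v t ∈ H3 :=
  UH3.curve_mem ⟨(p, v), h⟩ t

theorem hasDerivAt_geod (p v : L4) (t : ℝ) :
    HasDerivAt (geod p v) (Real.sinh t • p + Real.cosh t • v) t :=
  ((Real.hasDerivAt_cosh t).smul_const p).add ((Real.hasDerivAt_sinh t).smul_const v)

theorem IsUnitTangent.velocity_geod {p v : L4} (h : IsUnitTangent p v) (t : ℝ) :
    IsUnitTangent (geod p v t) (Real.sinh t • p + Real.cosh t • v) := by
  have hcs := Real.cosh_sq t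
  obtain ⟨hp, hpv, hv⟩ := id h
  refine ⟨geod_mem h t, ?_, ?_⟩ <;>
  · simp only [geod, lorentz_add_left, lorentz_add_right, lorentz_smul_left, lorentz_smul_right,
      lorentz_comm v p, hp.1, hpv, hv]
    nlinarith

theorem geod_add_velocity (p v : L4) (t : ℝ) :
    geod p v t + (Real.sinh t • p + Real.cosh t • v) = Real.exp t • (p + v) := by
  rw [← Real.cosh_add_sinh]; simp only [geod]; module

/-- The velocity of a geodesic that runs toward `N` (for `σ = 1`) or away from it (for `σ = -1`)
keeps this property. -/
theorem velocity_geod_toward {N y : L4} (hN : IsFutureNull N) (hy : y ∈ H3) {σ : ℝ}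
    (hσ : σ = 1 ∨ σ = -1) (t : ℝ) :
    Real.sinh t • y + Real.cosh t • (σ • toward N y)
      = σ • toward N (geod y (σ • toward N y) t) := by
  have hu := hN.isUnitTangent_toward hy
  rcases hσ with rfl | rfl
  · simp only [one_smul]
    refine eq_toward (hu.velocity_geod t) (r := Real.exp t * (-lorentz N y)⁻¹) ?_
    rw [geod_add_velocity, add_toward, smul_smul]
  · simp only [neg_one_smul]
    have := eq_toward (N := N) (hu.velocity_geod (-t)) (r := Real.exp (-t) * (-lorentz N y)⁻¹)
      (by rw [geod_add_velocity, add_toward, smul_smul])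
    rw [geod_neg, ← this, Real.sinh_neg, Real.cosh_neg]
    module

/-- The null vector `p + v`, up to a factor, determines the end point of the geodesic with the
initial vector `v` at `p`. -/
theorem asymptotic_of_add_eq_smul {N : L4} (g h : UH3) {r s : ℝ}
    (hN : IsFutureNull N) (hg : g.1.1 + g.1.2 = r • N) (hh : h.1.1 + h.1.2 = s • N) :
    Asymptotic g.curve h.curve := by
  obtain ⟨⟨p, v⟩, hp⟩ := g
  obtain ⟨⟨q, w⟩, hq⟩ := h
  simp only at hg hh
  refine (asymptotic_iff _ _).2 ?_
  have key (p v : L4) (t : ℝ) :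
      geod p v t = (Real.exp t / 2) • (p + v) + (Real.exp (-t) / 2) • (p - v) := by
    simp only [geod, Real.cosh_eq, Real.sinh_eq]; module
  refine ⟨|s * lorentz (p - v) N / 4| + |r * lorentz N (q - w) / 4| + |lorentz (p - v) (q - w) / 4|,
    fun t ht => ?_⟩
  simp only [UH3.curve]
  rw [key, key, hg, hh]
  simp only [lorentz_add_left, lorentz_add_right, lorentz_smul_left, lorentz_smul_right, hN.1]
  have e1 : Real.exp t * Real.exp (-t) = 1 := by rw [← Real.exp_add]; simp
  have e2 : Real.exp (-t) * Real.exp (-t) ≤ 1 := by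
    rw [← Real.exp_add]; exact Real.exp_le_one_iff.2 (by linarith)
  have e3 : 0 ≤ Real.exp (-t) * Real.exp (-t) := by positivity
  have h1 := neg_abs_le (s * lorentz (p - v) N / 4)
  have h2 := neg_abs_le (r * lorentz N (q - w) / 4)
  have h3 : -|lorentz (p - v) (q - w) / 4| ≤
      Real.exp (-t) * Real.exp (-t) * (lorentz (p - v) (q - w) / 4) := by
    have := neg_abs_le (Real.exp (-t) * Real.exp (-t) * (lorentz (p - v) (q - w) / 4))
    rw [abs_mul, abs_of_nonneg e3] at this
    nlinarith [abs_nonneg (lorentz (p - v) (q - w) / 4)]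
  calc _ = -(Real.exp t * Real.exp (-t)) * (s * lorentz (p - v) N / 4)
        - (Real.exp t * Real.exp (-t)) * (r * lorentz N (q - w) / 4)
        - Real.exp (-t) * Real.exp (-t) * (lorentz (p - v) (q - w) / 4) := by ring
    _ ≤ _ := by rw [e1]; linarith

/-! ### Charts, derivatives and unit normal fields -/

/-- The coordinate plane. -/
abbrev E2 : Type := EuclideanSpace ℝ (Fin 2)

/-- The coordinate vectors of the plane. -/
def coordVec (i : Fin 2) : E2 := EuclideanSpace.single i 1

@[simp] theorem coordVec_self (i : Fin 2) : coordVec i i = 1 := by simp [coordVec]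

@[simp] theorem coordVec_zero_one : coordVec 0 1 = 0 := by simp [coordVec]

@[simp] theorem coordVec_one_zero : coordVec 1 0 = 0 := by simp [coordVec]

theorem norm_coordVec (i : Fin 2) : ‖coordVec i‖ = 1 := by simp [coordVec]

theorem E2.eq_add (w : E2) : w = w 0 • coordVec 0 + w 1 • coordVec 1 := by
  ext i; fin_cases i <;> simp

theorem linearIndependent_coordVec {F : Type*} [AddCommGroup F] [Module ℝ F] {T : E2 →ₗ[ℝ] F}
    (hT : Function.Injective T) : LinearIndependent ℝ ![T (coordVec 0), T (coordVec 1)] := by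
  refine LinearIndependent.pair_iff.2 fun r s h => ?_
  have : T (r • coordVec 0 + s • coordVec 1) = T 0 := by simpa using h
  have h0 := hT this
  have a0 := congrArg (fun w : E2 => w 0) h0
  have a1 := congrArg (fun w : E2 => w 1) h0
  simp at a0 a1
  exact ⟨a0, a1⟩

variable {M : Type*} [TopologicalSpace M] [ChartedSpace E2 M]

section Chart

variable {φ : OpenPartialHomeomorph M E2} {x : E2}

/-- The differential of the inverse of a chart. -/
def chartDeriv (φ : OpenPartialHomeomorph M E2) (x : E2) :
    E2 →L[ℝ] TangentSpace (𝓡 2) (φ.symm x) :=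
  mfderiv (𝓡 2) (𝓡 2) φ.symm x

theorem hasMFDerivAt_chart_symm (hφ : φ ∈ IsManifold.maximalAtlas (𝓡 2) ∞ M) (hx : x ∈ φ.target) :
    HasMFDerivAt (𝓡 2) (𝓡 2) φ.symm x (chartDeriv φ x) :=
  ((contMDiffAt_symm_of_mem_maximalAtlas hφ hx).mdifferentiableAt (by simp)).hasMFDerivAt

theorem bijective_chartDeriv (hφ : φ ∈ IsManifold.maximalAtlas (𝓡 2) ∞ M) (hx : x ∈ φ.target) :
    Function.Bijective (chartDeriv φ x) := by
  have h1 : φ.MDifferentiable (𝓡 2) (𝓡 2) :=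
    ⟨(contMDiffOn_of_mem_maximalAtlas hφ).mdifferentiableOn (by simp),
      (contMDiffOn_symm_of_mem_maximalAtlas hφ).mdifferentiableOn (by simp)⟩
  exact h1.symm.mfderiv_bijective (x := x) (by simpa using hx)

theorem hasFDerivAt_comp_chart_symm (hφ : φ ∈ IsManifold.maximalAtlas (𝓡 2) ∞ M)
    (hx : x ∈ φ.target) {h : M → L4} (hh : MDifferentiableAt (𝓡 2) 𝓘(ℝ, L4) h (φ.symm x)) :
    HasFDerivAt (fun y => h (φ.symm y)) ((diff h (φ.symm x)).comp (chartDeriv φ x)) x :=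
  (hh.hasMFDerivAt.comp x (hasMFDerivAt_chart_symm hφ hx)).hasFDerivAt

theorem hasDerivAt_add_smul (x w : E2) (t : ℝ) : HasDerivAt (fun r : ℝ => x + r • w) w t := by
  simpa using ((hasDerivAt_id t).smul_const w).const_add x

theorem hasDerivAt_comp_chart_line (hφ : φ ∈ IsManifold.maximalAtlas (𝓡 2) ∞ M)
    (hx : x ∈ φ.target) {h : M → L4} (hh : MDifferentiableAt (𝓡 2) 𝓘(ℝ, L4) h (φ.symm x))
    (w : E2) :
    HasDerivAt (fun r : ℝ => h (φ.symm (x + r • w))) (diff h (φ.symm x) (chartDeriv φ x w)) 0 := by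
  have h1 := hasFDerivAt_comp_chart_symm hφ hx hh
  have h2 := hasDerivAt_add_smul x w 0
  have h3 : HasFDerivAt (fun y => h (φ.symm y)) ((diff h (φ.symm x)).comp (chartDeriv φ x))
      (x + (0 : ℝ) • w) := by simpa using h1
  exact h3.comp_hasDerivAt 0 h2

theorem contDiffAt_comp_chart_symm {n : WithTop ℕ∞} [IsManifold (𝓡 2) n M]
    (hφ : φ ∈ IsManifold.maximalAtlas (𝓡 2) n M) (hx : x ∈ φ.target) {h : M → L4}
    (hh : ContMDiffAt (𝓡 2) 𝓘(ℝ, L4) n h (φ.symm x)) :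
    ContDiffAt ℝ n (fun y => h (φ.symm y)) x :=
  (ContMDiffAt.comp x hh (contMDiffAt_symm_of_mem_maximalAtlas hφ hx)).contDiffAt

end Chart

theorem finrank_tangentSpace (q : M) : Module.finrank ℝ (TangentSpace (𝓡 2) q) = 2 := by
  change Module.finrank ℝ E2 = 2
  simp

/-- Every tangent vector is the velocity of a curve, in the sense of differentiating functions. -/
theorem exists_curve_of_tangent [IsManifold (𝓡 2) ∞ M] (q : M) (v : TangentSpace (𝓡 2) q) :
    ∃ ℓ : ℝ → M, ContinuousAt ℓ 0 ∧ ℓ 0 = q ∧ ∀ h : M → L4,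
      MDifferentiableAt (𝓡 2) 𝓘(ℝ, L4) h q → HasDerivAt (fun r => h (ℓ r)) (diff h q v) 0 := by
  obtain ⟨φ, x, hφ, hx, rfl⟩ : ∃ (φ : OpenPartialHomeomorph M E2) (x : E2),
      φ ∈ IsManifold.maximalAtlas (𝓡 2) ∞ M ∧ x ∈ φ.target ∧ φ.symm x = q :=
    ⟨chartAt E2 q, chartAt E2 q q, IsManifold.chart_mem_maximalAtlas q, by simp, by simp⟩
  obtain ⟨w, rfl⟩ := (bijective_chartDeriv hφ hx).2 v
  refine ⟨fun r => φ.symm (x + r • w), ?_, by simp, fun h hh =>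
    hasDerivAt_comp_chart_line hφ hx hh w⟩
  refine ContinuousAt.comp' ?_ (by fun_prop)
  simpa using φ.symm.continuousAt (x := x) (by simpa using hx)

/-- The product rule for a constant Lorentz product. -/
theorem lorentz_diff_add_lorentz_diff [IsManifold (𝓡 2) ∞ M] {h k : M → L4} {q : M}
    (hh : MDifferentiableAt (𝓡 2) 𝓘(ℝ, L4) h q) (hk : MDifferentiableAt (𝓡 2) 𝓘(ℝ, L4) k q)
    {r : ℝ} (hr : ∀ᶠ y in 𝓝 q, lorentz (h y) (k y) = r) (v : TangentSpace (𝓡 2) q) :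
    lorentz (diff h q v) (k q) + lorentz (h q) (diff k q v) = 0 := by
  obtain ⟨ℓ, hc, h0, hℓ⟩ := exists_curve_of_tangent q v
  have h1 := (hℓ h hh).lorentz (hℓ k hk)
  have h2 : (fun s => lorentz (h (ℓ s)) (k (ℓ s))) =ᶠ[𝓝 0] fun _ => r := by
    rw [ContinuousAt, h0] at hc
    exact hc.eventually hr
  have h3 := h1.unique ((hasDerivAt_const (0 : ℝ) r).congr_of_eventuallyEq h2)
  rwa [h0] at h3

section Surface

variable {f : M → L4}

theorem IsSurface.mdifferentiableAt {n : WithTop ℕ∞} (hn : n ≠ 0) (hf : IsSurface n f) (q : M) :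
    MDifferentiableAt (𝓡 2) 𝓘(ℝ, L4) f q :=
  hf.contMDiff.contMDiffAt.mdifferentiableAt hn

theorem IsSurface.lorentz_diff [IsManifold (𝓡 2) ∞ M] (hf : IsSurface ω f) (q : M)
    (v : TangentSpace (𝓡 2) q) : lorentz (f q) (diff f q v) = 0 := by
  have h := hf.mdifferentiableAt (by simp) q
  have := lorentz_diff_add_lorentz_diff h h (Filter.Eventually.of_forall fun y => (hf.mem_H3 y).1) v
  rw [lorentz_comm (diff f q v)] at this
  linarith

namespace IsUnitNormal

variable {U : Set M} {ν : M → L4}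

theorem contMDiffAt (hν : IsUnitNormal f U ν) {q : M} (hq : q ∈ U) :
    ContMDiffAt (𝓡 2) 𝓘(ℝ, L4) ∞ ν q :=
  hν.contMDiffOn.contMDiffAt (hν.isOpen.mem_nhds hq)

theorem mdifferentiableAt (hν : IsUnitNormal f U ν) {q : M} (hq : q ∈ U) :
    MDifferentiableAt (𝓡 2) 𝓘(ℝ, L4) ν q :=
  (hν.contMDiffAt hq).mdifferentiableAt (by simp)

variable [IsManifold (𝓡 2) ∞ M]

theorem isFrame (hν : IsUnitNormal f U ν) (hf : IsSurface ω f) {q : M} (hq : q ∈ U) :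
    IsFrame (f q) (diff f q).toLinearMap (ν q) where
  finrank := finrank_tangentSpace q
  injective := hf.injective_diff q
  mem_H3 := hf.mem_H3 q
  point_tangent := hf.lorentz_diff q
  point_normal := hν.tangent_H3 q hq
  unit := hν.unit q hq
  normal_tangent := hν.normal q hq

theorem lorentz_diff_point (hν : IsUnitNormal f U ν) (hf : IsSurface ω f) {q : M} (hq : q ∈ U)
    (v : TangentSpace (𝓡 2) q) : lorentz (diff ν q v) (f q) = 0 := by
  have := lorentz_diff_add_lorentz_diff (hν.mdifferentiableAt hq)
    (hf.mdifferentiableAt (by simp) q) (r := 0) (by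
      filter_upwards [hν.isOpen.mem_nhds hq] with y hy
      rw [lorentz_comm]; exact hν.tangent_H3 y hy) v
  rw [hν.normal q hq] at this
  linarith

theorem lorentz_diff_normal (hν : IsUnitNormal f U ν) {q : M} (hq : q ∈ U)
    (v : TangentSpace (𝓡 2) q) : lorentz (diff ν q v) (ν q) = 0 := by
  have := lorentz_diff_add_lorentz_diff (hν.mdifferentiableAt hq) (hν.mdifferentiableAt hq) (by
      filter_upwards [hν.isOpen.mem_nhds hq] with y hy
      exact hν.unit y hy) v
  rw [lorentz_comm (ν q)] at this
  linarith

/-- The defining property of the shape operator. -/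
theorem diff_shapeOperator (hν : IsUnitNormal f U ν) (hf : IsSurface ω f) {q : M} (hq : q ∈ U)
    (v : TangentSpace (𝓡 2) q) : diff f q (shapeOperator f ν q v) = -diff ν q v := by
  obtain ⟨w, hw⟩ := (hν.isFrame hf hq).exists_tangent (hν.lorentz_diff_point hf hq v)
    (hν.lorentz_diff_normal hq v)
  have hinj : LinearMap.ker (diff f q).toLinearMap = ⊥ :=
    LinearMap.ker_eq_bot.2 (hf.injective_diff q)
  have : (diff f q).toLinearMap.leftInverse ((diff f q).toLinearMap w) = w :=
    LinearMap.leftInverse_apply_of_inj hinj w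
  simp only [shapeOperator, LinearMap.neg_apply, LinearMap.comp_apply]
  have hw' : (diff ν q).toLinearMap v = (diff f q).toLinearMap w := hw.symm
  rw [hw', this, map_neg]
  exact congrArg Neg.neg hw

theorem shapeOperator_eq_zero (hν : IsUnitNormal f U ν) (hf : IsSurface ω f) {q : M} (hq : q ∈ U) :
    shapeOperator f ν q = 0 ↔ diff ν q = 0 := by
  constructor
  · intro h
    ext1 v
    have := hν.diff_shapeOperator hf hq v
    rw [h, LinearMap.zero_apply, map_zero] at this
    exact neg_eq_zero.1 this.symm
  · intro h
    ext1 v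
    refine hf.injective_diff q ?_
    rw [hν.diff_shapeOperator hf hq v, h]
    simp

/-- On an extrinsically flat surface the differential of a unit normal field has a kernel. -/
theorem exists_diff_eq_zero (hν : IsUnitNormal f U ν) (hf : IsSurface ω f)
    (hflat : IsExtrinsicallyFlat f) {q : M} (hq : q ∈ U) :
    ∃ v : TangentSpace (𝓡 2) q, v ≠ 0 ∧ diff ν q v = 0 := by
  have : FiniteDimensional ℝ (TangentSpace (𝓡 2) q) :=
    Module.finite_of_finrank_pos (by rw [finrank_tangentSpace]; norm_num)
  have hdet : LinearMap.det (shapeOperator f ν q) = 0 := hflat U ν hν q hq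
  have := LinearMap.bot_lt_ker_of_det_eq_zero hdet
  obtain ⟨v, hv, hv0⟩ := (Submodule.ne_bot_iff _).1 this.ne'
  refine ⟨v, hv0, ?_⟩
  have h := hν.diff_shapeOperator hf hq v
  rw [LinearMap.mem_ker.1 hv, map_zero] at h
  exact neg_eq_zero.1 h.symm

/-- Unit normal fields are locally unique up to the sign. -/
theorem eventually_eq_or_eq_neg (hν : IsUnitNormal f U ν) (hf : IsSurface ω f) {U' : Set M}
    {ν' : M → L4} (hν' : IsUnitNormal f U' ν') {q : M} (hq : q ∈ U) (hq' : q ∈ U') :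
    ν' =ᶠ[𝓝 q] ν ∨ ν' =ᶠ[𝓝 q] -ν := by
  have key : ∀ y ∈ U ∩ U', ν' y = ν y ∨ ν' y = -ν y := fun y hy =>
    (hν.isFrame hf hy.1).eq_or_eq_neg (by rw [lorentz_comm]; exact hν'.tangent_H3 y hy.2)
      (hν'.normal y hy.2) (hν'.unit y hy.2)
  have hU := (hν.isOpen.inter hν'.isOpen).mem_nhds ⟨hq, hq'⟩
  have hcont : ContinuousAt (fun y => lorentz (ν' y) (ν y)) q :=
    continuous_lorentz.continuousAt.comp
      (((hν'.contMDiffAt hq').continuousAt).prodMk ((hν.contMDiffAt hq).continuousAt))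
  rcases key q ⟨hq, hq'⟩ with h | h
  · left
    have h1 : lorentz (ν' q) (ν q) = 1 := by rw [h, hν.unit q hq]
    filter_upwards [hU,
      hcont.eventually (lt_mem_nhds (h1 ▸ one_pos : (0 : ℝ) < lorentz (ν' q) (ν q)))]
      with y hy hpos
    refine (key y hy).resolve_right fun h2 => ?_
    rw [h2, lorentz_neg_left, hν.unit y hy.1] at hpos
    linarith
  · right
    have h1 : lorentz (ν' q) (ν q) = -1 := by rw [h, lorentz_neg_left, hν.unit q hq]
    filter_upwards [hU,
      hcont.eventually (gt_mem_nhds (h1 ▸ neg_one_lt_zero : lorentz (ν' q) (ν q) < (0 : ℝ)))]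
      with y hy hneg
    refine (key y hy).resolve_left fun h2 => ?_
    rw [h2, hν.unit y hy.1] at hneg
    linarith

/-- On an extrinsically flat surface, the umbilic points are the critical points of the unit normal
field. -/
theorem isUmbilic_iff (hν : IsUnitNormal f U ν) (hf : IsSurface ω f)
    (hflat : IsExtrinsicallyFlat f) {q : M} (hq : q ∈ U) : IsUmbilic f q ↔ diff ν q = 0 := by
  constructor
  · rintro ⟨U', ν', hν', hq', k, hk⟩
    obtain ⟨v, hv0, hv⟩ := hν'.exists_diff_eq_zero hf hflat hq'
    have h1 := hν'.diff_shapeOperator hf hq' v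
    have hsv : shapeOperator f ν' q v = 0 := by
      refine hf.injective_diff q ?_
      rw [h1, hv, map_zero, neg_zero]
    have hk0 : k = 0 := by
      rw [hk, LinearMap.smul_apply, LinearMap.id_apply] at hsv
      exact (smul_eq_zero.1 hsv).resolve_right hv0
    rw [hk0, zero_smul] at hk
    have hd := (hν'.shapeOperator_eq_zero hf hq').1 hk
    rcases hν'.eventually_eq_or_eq_neg hf hν hq' hq with h | h
    · rw [diff, h.mfderiv_eq]
      exact hd
    · ext1 v
      obtain ⟨ℓ, hc, h0, hℓ⟩ := exists_curve_of_tangent q v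
      have a := hℓ ν (hν.mdifferentiableAt hq)
      have b := (hℓ ν' (hν'.mdifferentiableAt hq')).neg
      rw [ContinuousAt, h0] at hc
      rw [a.unique (b.congr_of_eventuallyEq (hc.eventually h)), hd]
      simp
  · intro h
    exact ⟨U, ν, hν, hq, 0, by rw [zero_smul]; exact (hν.shapeOperator_eq_zero hf hq).2 h⟩

end IsUnitNormal

/-- The (unnormalized) normal field of a surface in the coordinates of a chart. -/
def chartCross (f : M → L4) (φ : OpenPartialHomeomorph M E2) (x : E2) : L4 :=
  cross (f (φ.symm x)) (fderiv ℝ (fun y => f (φ.symm y)) x (coordVec 0))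
    (fderiv ℝ (fun y => f (φ.symm y)) x (coordVec 1))

theorem contDiffAt_chartCross {n : WithTop ℕ∞} (hn : n + 1 ≤ n)
    [IsManifold (𝓡 2) n M] (hf : IsSurface ω f) {φ : OpenPartialHomeomorph M E2}
    (hφ : φ ∈ IsManifold.maximalAtlas (𝓡 2) n M) {x : E2} (hx : x ∈ φ.target) :
    ContDiffAt ℝ n (chartCross f φ) x := by
  have h := contDiffAt_comp_chart_symm hφ hx
    (hf.contMDiff.contMDiffAt.of_le (le_top : n ≤ ω))
  have h' := h.fderiv_right hn
  exact h.cross (h'.clm_apply contDiffAt_const) (h'.clm_apply contDiffAt_const)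

theorem fderiv_comp_chart_symm (hf : IsSurface ω f) {φ : OpenPartialHomeomorph M E2}
    (hφ : φ ∈ IsManifold.maximalAtlas (𝓡 2) ∞ M) {x : E2} (hx : x ∈ φ.target) :
    fderiv ℝ (fun y => f (φ.symm y)) x = (diff f (φ.symm x)).comp (chartDeriv φ x) :=
  (hasFDerivAt_comp_chart_symm hφ hx (hf.mdifferentiableAt (by simp) _)).fderiv

theorem lorentz_chartCross_diff (hf : IsSurface ω f) {φ : OpenPartialHomeomorph M E2}
    (hφ : φ ∈ IsManifold.maximalAtlas (𝓡 2) ∞ M) {x : E2} (hx : x ∈ φ.target)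
    (v : TangentSpace (𝓡 2) (φ.symm x)) :
    lorentz (chartCross f φ x) (diff f (φ.symm x) v) = 0 := by
  obtain ⟨w, rfl⟩ := (bijective_chartDeriv hφ hx).2 v
  change lorentz _ (((diff f (φ.symm x)).comp (chartDeriv φ x)) w) = 0
  rw [← fderiv_comp_chart_symm hf hφ hx, E2.eq_add w, map_add, map_smul, map_smul,
    lorentz_add_right, lorentz_smul_right, lorentz_smul_right, chartCross, lorentz_cross_second,
    lorentz_cross_third]
  ring

variable [IsManifold (𝓡 2) ∞ M]

theorem lorentz_chartCross_self_pos (hf : IsSurface ω f) {φ : OpenPartialHomeomorph M E2}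
    (hφ : φ ∈ IsManifold.maximalAtlas (𝓡 2) ∞ M) {x : E2} (hx : x ∈ φ.target) :
    0 < lorentz (chartCross f φ x) (chartCross f φ x) := by
  unfold chartCross
  rw [fderiv_comp_chart_symm hf hφ hx]
  refine lorentz_cross_self_pos (hf.mem_H3 _) (hf.lorentz_diff _ _) (hf.lorentz_diff _ _) ?_
  exact linearIndependent_coordVec
    (T := ((diff f (φ.symm x)).comp (chartDeriv φ x)).toLinearMap)
    ((hf.injective_diff _).comp (bijective_chartDeriv hφ hx).1)

/-- The unit normal field of a surface in the domain of a chart. -/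
def chartNormal (f : M → L4) (φ : OpenPartialHomeomorph M E2) (q : M) : L4 :=
  (Real.sqrt (lorentz (chartCross f φ (φ q)) (chartCross f φ (φ q))))⁻¹ • chartCross f φ (φ q)

theorem isUnitNormal_chartNormal (hf : IsSurface ω f) {φ : OpenPartialHomeomorph M E2}
    (hφ : φ ∈ IsManifold.maximalAtlas (𝓡 2) ∞ M) :
    IsUnitNormal f φ.source (chartNormal f φ) where
  isOpen := φ.open_source
  contMDiffOn := by
    intro q hq
    have hx := φ.map_source hq
    have h1 : ContDiffAt ℝ ∞ (chartCross f φ) (φ q) := contDiffAt_chartCross (by simp) hf hφ hx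
    have hpos := lorentz_chartCross_self_pos hf hφ hx
    have h2 : ContDiffAt ℝ ∞
        (fun x => (Real.sqrt (lorentz (chartCross f φ x) (chartCross f φ x)))⁻¹ • chartCross f φ x)
        (φ q) :=
      (((h1.lorentz h1).sqrt hpos.ne').inv (Real.sqrt_pos.2 hpos).ne').smul h1
    exact (ContMDiffAt.comp q h2.contMDiffAt
      (contMDiffAt_of_mem_maximalAtlas hφ hq)).contMDiffWithinAt
  tangent_H3 := by
    intro q hq
    rw [chartNormal, lorentz_smul_right, lorentz_comm (f q), chartCross, φ.left_inv hq,
      lorentz_cross_first, mul_zero]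
  unit := by
    intro q hq
    have hpos := lorentz_chartCross_self_pos hf hφ (φ.map_source hq)
    rw [chartNormal, lorentz_smul_left, lorentz_smul_right, ← mul_assoc, ← mul_inv,
      Real.mul_self_sqrt hpos.le]
    exact inv_mul_cancel₀ hpos.ne'
  normal := by
    intro q hq w
    have h := lorentz_chartCross_diff hf hφ (φ.map_source hq)
    rw [φ.left_inv hq] at h
    rw [chartNormal, lorentz_smul_left, h, mul_zero]

theorem exists_isUnitNormal (hf : IsSurface ω f) (q : M) :
    ∃ U ν, IsUnitNormal f U ν ∧ q ∈ U :=
  ⟨_, _, isUnitNormal_chartNormal hf (IsManifold.chart_mem_maximalAtlas q), mem_chart_source E2 q⟩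

end Surface

/-! ### Developable surfaces in ruled coordinates -/

/-- The derivative `∂f/∂s` of a ruled surface `f(s, t) = cosh t • c s + sinh t • v s`. -/
def ruledS (c v : ℝ → L4) (x : E2) : L4 :=
  Real.cosh (x 1) • deriv c (x 0) + Real.sinh (x 1) • deriv v (x 0)

/-- The derivative `∂f/∂t` of a ruled surface `f(s, t) = cosh t • c s + sinh t • v s`. -/
def ruledT (c v : ℝ → L4) (x : E2) : L4 :=
  Real.sinh (x 1) • c (x 0) + Real.cosh (x 1) • v (x 0)

/-- The mixed derivative `∂²f/∂s∂t` of a ruled surface `f(s, t) = cosh t • c s + sinh t • v s`. -/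
def ruledST (c v : ℝ → L4) (x : E2) : L4 :=
  Real.sinh (x 1) • deriv c (x 0) + Real.cosh (x 1) • deriv v (x 0)

theorem eventually_add_smul_mem {W : Set E2} (hW : IsOpen W) {x : E2} (hx : x ∈ W) (w : E2) :
    ∀ᶠ r in 𝓝 (0 : ℝ), x + r • w ∈ W := by
  have : ContinuousAt (fun r : ℝ => x + r • w) 0 := by fun_prop
  exact this.eventually_mem (hW.mem_nhds (by simpa using hx))

theorem hasDerivAt_comp_add_mul {F : Type*} [NormedAddCommGroup F] [NormedSpace ℝ F] {g : ℝ → F}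
    {g' : F} {a : ℝ} (b : ℝ) (h : HasDerivAt g g' a) :
    HasDerivAt (fun r : ℝ => g (a + r * b)) (b • g') 0 := by
  have h1 : HasDerivAt (fun r : ℝ => a + r * b) b 0 := by
    simpa using ((hasDerivAt_id (0 : ℝ)).mul_const b).const_add a
  have h2 : HasDerivAt g g' (a + 0 * b) := by simpa using h
  exact h2.scomp 0 h1

/-- The derivatives of a normal field in the coordinate directions. -/
def normalDeriv (ν : M → L4) (φ : OpenPartialHomeomorph M E2) (i : Fin 2) (x : E2) :
    L4 :=
  diff ν (φ.symm x) (chartDeriv φ x (coordVec i))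

section RuledChart

variable {f : M → L4} {φ : OpenPartialHomeomorph M E2} {c v : ℝ → L4} {x : E2}

namespace IsRuledChart

theorem hasDerivAt_curve (hR : IsRuledChart f φ c v) (hx : x ∈ φ.target) :
    HasDerivAt c (deriv c (x 0)) (x 0) :=
  ((hR.contDiffAt_curve x hx).differentiableAt (by simp)).hasDerivAt

theorem hasDerivAt_field (hR : IsRuledChart f φ c v) (hx : x ∈ φ.target) :
    HasDerivAt v (deriv v (x 0)) (x 0) :=
  ((hR.contDiffAt_field x hx).differentiableAt (by simp)).hasDerivAt

theorem continuousAt_ruledT (hR : IsRuledChart f φ c v) (hx : x ∈ φ.target) :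
    ContinuousAt (ruledT c v) x := by
  have h0 : ContinuousAt (fun y : E2 => y 0) x := by fun_prop
  have hc : ContinuousAt (fun y : E2 => c (y 0)) x :=
    ContinuousAt.comp' (f := fun y : E2 => y 0) (hR.hasDerivAt_curve hx).continuousAt h0
  have hv : ContinuousAt (fun y : E2 => v (y 0)) x :=
    ContinuousAt.comp' (f := fun y : E2 => y 0) (hR.hasDerivAt_field hx).continuousAt h0
  have h1 : ContinuousAt (fun y : E2 => Real.sinh (y 1)) x := by fun_prop
  have h2 : ContinuousAt (fun y : E2 => Real.cosh (y 1)) x := by fun_prop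
  exact (h1.smul hc).add (h2.smul hv)

theorem continuousAt_deriv_curve (hR : IsRuledChart f φ c v) (hx : x ∈ φ.target) :
    ContinuousAt (fun y : E2 => deriv c (y 0)) x :=
  ContinuousAt.comp' (f := fun y : E2 => y 0)
    ((hR.contDiffAt_curve x hx).derivWithin (m := 0) (by simp)).continuousAt (by fun_prop)

theorem continuousAt_deriv_field (hR : IsRuledChart f φ c v) (hx : x ∈ φ.target) :
    ContinuousAt (fun y : E2 => deriv v (y 0)) x :=
  ContinuousAt.comp' (f := fun y : E2 => y 0)
    ((hR.contDiffAt_field x hx).derivWithin (m := 0) (by simp)).continuousAt (by fun_prop)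

theorem continuousAt_ruledS (hR : IsRuledChart f φ c v) (hx : x ∈ φ.target) :
    ContinuousAt (ruledS c v) x := by
  have h1 : ContinuousAt (fun y : E2 => Real.sinh (y 1)) x := by fun_prop
  have h2 : ContinuousAt (fun y : E2 => Real.cosh (y 1)) x := by fun_prop
  exact (h2.smul (hR.continuousAt_deriv_curve hx)).add (h1.smul (hR.continuousAt_deriv_field hx))

theorem lorentz_deriv (hR : IsRuledChart f φ c v) (hx : x ∈ φ.target) :
    lorentz (deriv c (x 0)) (c (x 0)) = 0 ∧ lorentz (deriv v (x 0)) (v (x 0)) = 0 ∧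
      lorentz (deriv v (x 0)) (c (x 0)) = 0 := by
  have hc := hasDerivAt_comp_add_mul 1 (hR.hasDerivAt_curve hx)
  have hv := hasDerivAt_comp_add_mul 1 (hR.hasDerivAt_field hx)
  simp only [mul_one, one_smul] at hc hv
  have key : ∀ᶠ r in 𝓝 (0 : ℝ), IsUnitTangent (c (x 0 + r)) (v (x 0 + r)) := by
    filter_upwards [eventually_add_smul_mem φ.open_target hx (coordVec 0)] with r hr
    simpa using hR.isUnitTangent _ hr
  have h1 := (hc.lorentz hc).unique ((hasDerivAt_const (0 : ℝ) (-1 : ℝ)).congr_of_eventuallyEq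
    (by filter_upwards [key] with r hr using hr.1.1))
  have h2 := (hv.lorentz hv).unique ((hasDerivAt_const (0 : ℝ) (1 : ℝ)).congr_of_eventuallyEq
    (by filter_upwards [key] with r hr using hr.2.2))
  have h3 := (hc.lorentz hv).unique ((hasDerivAt_const (0 : ℝ) (0 : ℝ)).congr_of_eventuallyEq
    (by filter_upwards [key] with r hr using hr.2.1))
  simp only [add_zero] at h1 h2 h3
  rw [lorentz_comm (c (x 0))] at h1 h3
  rw [lorentz_comm (v (x 0))] at h2
  have h4 := hR.normal x hx
  exact ⟨by linarith, by linarith, by linarith⟩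

theorem lorentz_ruledS_ruledT (hR : IsRuledChart f φ c v) (hx : x ∈ φ.target) :
    lorentz (ruledS c v x) (ruledT c v x) = 0 := by
  obtain ⟨h1, h2, h3⟩ := hR.lorentz_deriv hx
  simp only [ruledS, ruledT, lorentz_add_left, lorentz_add_right, lorentz_smul_left,
    lorentz_smul_right, h1, h2, h3, hR.normal x hx]
  ring

theorem isUnitTangent_ruledT (hR : IsRuledChart f φ c v) (hx : x ∈ φ.target) :
    IsUnitTangent (f (φ.symm x)) (ruledT c v x) := by
  rw [hR.eq_geod x hx]
  exact (hR.isUnitTangent x hx).velocity_geod (x 1)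

theorem diff_coordVec_zero (hR : IsRuledChart f φ c v) (hf : IsSurface ω f) (hx : x ∈ φ.target) :
    diff f (φ.symm x) (chartDeriv φ x (coordVec 0)) = ruledS c v x := by
  refine (hasDerivAt_comp_chart_line hR.mem_atlas hx (hf.mdifferentiableAt (by simp) _)
    (coordVec 0)).unique ?_
  have h := ((hasDerivAt_comp_add_mul 1 (hR.hasDerivAt_curve hx)).const_smul (Real.cosh (x 1))).add
    ((hasDerivAt_comp_add_mul 1 (hR.hasDerivAt_field hx)).const_smul (Real.sinh (x 1)))
  simp only [one_smul, mul_one] at h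
  refine h.congr_of_eventuallyEq ?_
  filter_upwards [eventually_add_smul_mem φ.open_target hx (coordVec 0)] with r hr
  rw [hR.eq_geod _ hr]
  simp [geod]

theorem diff_coordVec_one (hR : IsRuledChart f φ c v) (hf : IsSurface ω f) (hx : x ∈ φ.target) :
    diff f (φ.symm x) (chartDeriv φ x (coordVec 1)) = ruledT c v x := by
  refine (hasDerivAt_comp_chart_line hR.mem_atlas hx (hf.mdifferentiableAt (by simp) _)
    (coordVec 1)).unique ?_
  have h := hasDerivAt_comp_add_mul 1 (hasDerivAt_geod (c (x 0)) (v (x 0)) (x 1))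
  simp only [one_smul, mul_one] at h
  refine h.congr_of_eventuallyEq ?_
  filter_upwards [eventually_add_smul_mem φ.open_target hx (coordVec 1)] with r hr
  rw [hR.eq_geod _ hr]
  simp

theorem ruledS_ne_zero (hR : IsRuledChart f φ c v) (hf : IsSurface ω f) (hx : x ∈ φ.target) :
    ruledS c v x ≠ 0 := by
  rw [← hR.diff_coordVec_zero hf hx]
  intro h
  have h1 := (hf.injective_diff _).comp (bijective_chartDeriv hR.mem_atlas hx).1
    (a₁ := coordVec 0) (a₂ := 0) (by simp [h])
  simpa using congrArg (fun w : E2 => w 0) h1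

variable {U : Set M} {ν : M → L4}

theorem lorentz_normal (hR : IsRuledChart f φ c v) (hf : IsSurface ω f) (hν : IsUnitNormal f U ν)
    (hx : x ∈ φ.target) (hU : φ.symm x ∈ U) :
    lorentz (ν (φ.symm x)) (ruledS c v x) = 0 ∧ lorentz (ν (φ.symm x)) (ruledT c v x) = 0 := by
  rw [← hR.diff_coordVec_zero hf hx, ← hR.diff_coordVec_one hf hx]
  exact ⟨hν.normal _ hU _, hν.normal _ hU _⟩

theorem hasDerivAt_normal (hR : IsRuledChart f φ c v) (hν : IsUnitNormal f U ν)
    (hx : x ∈ φ.target) (hU : φ.symm x ∈ U) (i : Fin 2) :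
    HasDerivAt (fun r : ℝ => ν (φ.symm (x + r • coordVec i))) (normalDeriv ν φ i x) 0 :=
  hasDerivAt_comp_chart_line hR.mem_atlas hx (hν.mdifferentiableAt hU) (coordVec i)

/-- The derivative of `⟨ν, ∂f/∂t⟩ = 0` along `s`. -/
theorem lorentz_normalDeriv_zero_ruledT (hR : IsRuledChart f φ c v) (hf : IsSurface ω f)
    (hν : IsUnitNormal f U ν) (hx : x ∈ φ.target) (hU : φ.symm x ∈ U) :
    lorentz (normalDeriv ν φ 0 x) (ruledT c v x)
      + lorentz (ν (φ.symm x)) (ruledST c v x) = 0 := by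
  have h := ((hasDerivAt_comp_add_mul 1 (hR.hasDerivAt_curve hx)).const_smul (Real.sinh (x 1))).add
    ((hasDerivAt_comp_add_mul 1 (hR.hasDerivAt_field hx)).const_smul (Real.cosh (x 1)))
  have h1 := ((hR.hasDerivAt_normal hν hx hU 0).lorentz h).unique
    ((hasDerivAt_const (0 : ℝ) (0 : ℝ)).congr_of_eventuallyEq (by
      filter_upwards [eventually_add_smul_mem (φ.symm.isOpen_inter_preimage hν.isOpen) ⟨hx, hU⟩
        (coordVec 0)] with r hr
      simpa [ruledT] using (hR.lorentz_normal hf hν hr.1 hr.2).2))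
  simpa [ruledT, ruledST] using h1

/-- The derivative of `⟨ν, ∂f/∂s⟩ = 0` along `t`. -/
theorem lorentz_normalDeriv_one_ruledS (hR : IsRuledChart f φ c v) (hf : IsSurface ω f)
    (hν : IsUnitNormal f U ν) (hx : x ∈ φ.target) (hU : φ.symm x ∈ U) :
    lorentz (normalDeriv ν φ 1 x) (ruledS c v x)
      + lorentz (ν (φ.symm x)) (ruledST c v x) = 0 := by
  have h := hasDerivAt_comp_add_mul 1
    (hasDerivAt_geod (deriv c (x 0)) (deriv v (x 0)) (x 1))
  have h1 := ((hR.hasDerivAt_normal hν hx hU 1).lorentz h).unique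
    ((hasDerivAt_const (0 : ℝ) (0 : ℝ)).congr_of_eventuallyEq (by
      filter_upwards [eventually_add_smul_mem (φ.symm.isOpen_inter_preimage hν.isOpen) ⟨hx, hU⟩
        (coordVec 1)] with r hr
      simpa [ruledS, geod] using (hR.lorentz_normal hf hν hr.1 hr.2).1))
  simpa [ruledS, ruledST, geod] using h1

/-- The derivative of `⟨ν, ∂f/∂t⟩ = 0` along `t`, where `∂²f/∂t² = f`. -/
theorem lorentz_normalDeriv_one_ruledT [IsManifold (𝓡 2) ∞ M] (hR : IsRuledChart f φ c v)
    (hf : IsSurface ω f) (hν : IsUnitNormal f U ν) (hx : x ∈ φ.target) (hU : φ.symm x ∈ U) :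
    lorentz (normalDeriv ν φ 1 x) (ruledT c v x) = 0 := by
  have h := ((Real.hasDerivAt_sinh (x 1)).smul_const (c (x 0))).add
    ((Real.hasDerivAt_cosh (x 1)).smul_const (v (x 0)))
  have h1 := ((hR.hasDerivAt_normal hν hx hU 1).lorentz (hasDerivAt_comp_add_mul 1 h)).unique
    ((hasDerivAt_const (0 : ℝ) (0 : ℝ)).congr_of_eventuallyEq (by
      filter_upwards [eventually_add_smul_mem (φ.symm.isOpen_inter_preimage hν.isOpen) ⟨hx, hU⟩
        (coordVec 1)] with r hr
      simpa [ruledT] using (hR.lorentz_normal hf hν hr.1 hr.2).2))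
  have h2 : lorentz (ν (φ.symm x)) (geod (c (x 0)) (v (x 0)) (x 1)) = 0 := by
    rw [← hR.eq_geod x hx, lorentz_comm]; exact hν.tangent_H3 _ hU
  simp only [geod] at h2
  simpa [ruledT, h2] using h1

variable [IsManifold (𝓡 2) ∞ M]

/-- Along the rulings of a developable surface the unit normal vector is constant. The matrix of the
second fundamental form in the coordinates `s, t` has the diagonal entry `0` for `t`; as it is
symmetric and degenerate, the off-diagonal entries vanish as well. -/
theorem normalDeriv_one (hR : IsRuledChart f φ c v) (hf : IsSurface ω f)
    (hflat : IsExtrinsicallyFlat f) (hν : IsUnitNormal f U ν) (hx : x ∈ φ.target)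
    (hU : φ.symm x ∈ U) : normalDeriv ν φ 1 x = 0 := by
  obtain ⟨w, hw0, hw⟩ := hν.exists_diff_eq_zero hf hflat hU
  obtain ⟨w, rfl⟩ := (bijective_chartDeriv hR.mem_atlas hx).2 w
  have hw' : w 0 • normalDeriv ν φ 0 x + w 1 • normalDeriv ν φ 1 x = 0 := by
    rw [E2.eq_add w, map_add, map_smul, map_smul, map_add, map_smul, map_smul] at hw
    exact hw
  have hTT := hR.lorentz_normalDeriv_one_ruledT hf hν hx hU
  by_cases h0 : w 0 = 0
  · have h1 : w 1 ≠ 0 := by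
      intro h1
      refine hw0 ?_
      rw [E2.eq_add w, h0, h1]; simp
    rw [h0, zero_smul, zero_add] at hw'
    exact (smul_eq_zero.1 hw').resolve_left h1
  · have hST : lorentz (normalDeriv ν φ 0 x) (ruledT c v x) = 0 := by
      have := congrArg (fun z => lorentz z (ruledT c v x)) hw'
      simp only [lorentz_add_left, lorentz_smul_left, hTT, lorentz_zero_left, mul_zero,
        add_zero] at this
      exact (mul_eq_zero.1 this).resolve_left h0
    have hTS : lorentz (normalDeriv ν φ 1 x) (ruledS c v x) = 0 := by
      have h1 := hR.lorentz_normalDeriv_zero_ruledT hf hν hx hU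
      have h2 := hR.lorentz_normalDeriv_one_ruledS hf hν hx hU
      linarith
    refine (hν.isFrame hf hU).eq_zero (hν.lorentz_diff_point hf hU _) (fun u => ?_)
      (hν.lorentz_diff_normal hU _)
    obtain ⟨u, rfl⟩ := (bijective_chartDeriv hR.mem_atlas hx).2 u
    rw [E2.eq_add u, map_add, map_smul, map_smul]
    change lorentz (normalDeriv ν φ 1 x) (diff f _ (_ + _)) = 0
    rw [map_add, map_smul, map_smul, hR.diff_coordVec_zero hf hx, hR.diff_coordVec_one hf hx,
      lorentz_add_right, lorentz_smul_right, lorentz_smul_right, hTT, hTS]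
    ring

/-- As `∂/∂t` is in the kernel of the shape operator, `∂/∂s` is an eigenvector. -/
theorem exists_normalDeriv_zero_eq (hR : IsRuledChart f φ c v) (hf : IsSurface ω f)
    (hflat : IsExtrinsicallyFlat f) (hν : IsUnitNormal f U ν) (hx : x ∈ φ.target)
    (hU : φ.symm x ∈ U) : ∃ k : ℝ, normalDeriv ν φ 0 x = -k • ruledS c v x := by
  have hST : lorentz (normalDeriv ν φ 0 x) (ruledT c v x) = 0 := by
    have h1 := hR.lorentz_normalDeriv_zero_ruledT hf hν hx hU
    have h2 := hR.lorentz_normalDeriv_one_ruledS hf hν hx hU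
    rw [hR.normalDeriv_one hf hflat hν hx hU, lorentz_zero_left] at h2
    linarith
  obtain ⟨u, hu⟩ := (hν.isFrame hf hU).exists_tangent (x := normalDeriv ν φ 0 x)
    (hν.lorentz_diff_point hf hU _) (hν.lorentz_diff_normal hU _)
  obtain ⟨u, rfl⟩ := (bijective_chartDeriv hR.mem_atlas hx).2 u
  have hu' : u 0 • ruledS c v x + u 1 • ruledT c v x = normalDeriv ν φ 0 x := by
    rw [← hu, ← hR.diff_coordVec_zero hf hx, ← hR.diff_coordVec_one hf hx]
    change _ = diff f _ (chartDeriv φ x u)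
    conv_rhs => rw [E2.eq_add u]
    simp only [map_add, map_smul]
  have h1 : u 1 = 0 := by
    rw [← hu', lorentz_add_left, lorentz_smul_left, lorentz_smul_left,
      hR.lorentz_ruledS_ruledT hx, (hR.isUnitTangent_ruledT hx).2.2] at hST
    linarith
  exact ⟨-u 0, by rw [← hu', h1]; module⟩

theorem diff_eq_zero_iff (hR : IsRuledChart f φ c v) (hf : IsSurface ω f)
    (hflat : IsExtrinsicallyFlat f) (hν : IsUnitNormal f U ν) (hx : x ∈ φ.target)
    (hU : φ.symm x ∈ U) : diff ν (φ.symm x) = 0 ↔ normalDeriv ν φ 0 x = 0 := by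
  constructor
  · intro h
    rw [normalDeriv, h]; rfl
  · intro h
    ext1 u
    obtain ⟨u, rfl⟩ := (bijective_chartDeriv hR.mem_atlas hx).2 u
    change diff ν _ (chartDeriv φ x u) = 0
    rw [E2.eq_add u]
    simp only [map_add, map_smul]
    change u 0 • normalDeriv ν φ 0 x + u 1 • normalDeriv ν φ 1 x = 0
    rw [h, hR.normalDeriv_one hf hflat hν hx hU]
    simp

/-- The only possibly nonzero principal curvature is `k`, in the direction `∂/∂s`. -/
theorem meanCurvature_eq (hR : IsRuledChart f φ c v) (hf : IsSurface ω f)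
    (hflat : IsExtrinsicallyFlat f) (hν : IsUnitNormal f U ν) (hx : x ∈ φ.target)
    (hU : φ.symm x ∈ U) {k : ℝ} (hk : normalDeriv ν φ 0 x = -k • ruledS c v x) :
    meanCurvature f ν (φ.symm x) = k / 2 := by
  let D : E2 ≃ₗ[ℝ] TangentSpace (𝓡 2) (φ.symm x) :=
    LinearEquiv.ofBijective (chartDeriv φ x).toLinearMap (bijective_chartDeriv hR.mem_atlas hx)
  let b := (EuclideanSpace.basisFun (Fin 2) ℝ).toBasis.map D
  have hb (i : Fin 2) : b i = chartDeriv φ x (coordVec i) := by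
    simp [b, D, coordVec]
  have h0 : shapeOperator f ν (φ.symm x) (b 0) = k • b 0 := by
    refine hf.injective_diff _ ?_
    rw [hν.diff_shapeOperator hf hU, hb, map_smul, hR.diff_coordVec_zero hf hx]
    change -normalDeriv ν φ 0 x = _
    rw [hk]; module
  have h1 : shapeOperator f ν (φ.symm x) (b 1) = 0 := by
    refine hf.injective_diff _ ?_
    rw [hν.diff_shapeOperator hf hU, hb, map_zero]
    change -normalDeriv ν φ 1 x = _
    rw [hR.normalDeriv_one hf hflat hν hx hU, neg_zero]
  rw [meanCurvature, LinearMap.trace_eq_matrix_trace ℝ b, Matrix.trace_fin_two,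
    LinearMap.toMatrix_apply, LinearMap.toMatrix_apply, h0, h1]
  simp

end IsRuledChart

end RuledChart

/-! ### The vertex determined near a non-umbilic point -/

section Vertex

variable {f : M → L4} {φ : OpenPartialHomeomorph M E2} {c v : ℝ → L4} {x : E2}

theorem continuousAt_normalDeriv [IsManifold (𝓡 2) ∞ M] {U : Set M} {ν : M → L4}
    (hφ : φ ∈ IsManifold.maximalAtlas (𝓡 2) ∞ M)
    (hν : IsUnitNormal f U ν) (hx : x ∈ φ.target) (hU : φ.symm x ∈ U) (i : Fin 2) :
    ContinuousAt (normalDeriv ν φ i) x := by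
  have h1 := contDiffAt_comp_chart_symm hφ hx (hν.contMDiffAt hU)
  have h2 : ContinuousAt (fun y => fderiv ℝ (fun z => ν (φ.symm z)) y (coordVec i)) x :=
    (h1.continuousAt_fderiv (by simp)).clm_apply continuousAt_const
  refine h2.congr ?_
  filter_upwards [(φ.symm.isOpen_inter_preimage hν.isOpen).mem_nhds ⟨hx, hU⟩] with y hy
  rw [(hasFDerivAt_comp_chart_symm hφ hy.1 (hν.mdifferentiableAt hy.2)).fderiv]
  rfl

/-- The ruling through the point with coordinates `x`. -/
def ruling (φ : OpenPartialHomeomorph M E2) (x : E2) (t : ℝ) : M :=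
  φ.symm (x + t • coordVec 1)

theorem contMDiffAt_ruling (hφ : φ ∈ IsManifold.maximalAtlas (𝓡 2) ∞ M) {t : ℝ}
    (ht : x + t • coordVec 1 ∈ φ.target) :
    ContMDiffAt 𝓘(ℝ, ℝ) (𝓡 2) ∞ (ruling φ x) t := by
  have h1 : ContMDiffAt 𝓘(ℝ, ℝ) 𝓘(ℝ, E2) ∞ (fun t : ℝ => x + t • coordVec 1) t := by
    refine ContDiffAt.contMDiffAt ?_
    fun_prop
  exact ContMDiffAt.comp t (contMDiffAt_symm_of_mem_maximalAtlas hφ ht) h1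

theorem velocity_ruling (hφ : φ ∈ IsManifold.maximalAtlas (𝓡 2) ∞ M) {t : ℝ}
    (ht : x + t • coordVec 1 ∈ φ.target) :
    velocity (ruling φ x) t = chartDeriv φ (x + t • coordVec 1) (coordVec 1) := by
  have h1 := (hasDerivAt_add_smul x (coordVec 1) t).hasFDerivAt.hasMFDerivAt
  have h2 := (hasMFDerivAt_chart_symm hφ ht).comp t h1
  rw [velocity]
  have h3 : mfderiv 𝓘(ℝ, ℝ) (𝓡 2) (ruling φ x) t = _ := h2.mfderiv
  rw [h3]
  change chartDeriv φ (x + t • coordVec 1) ((1 : ℝ) • coordVec 1) = _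
  rw [one_smul]

namespace IsRuledChart

variable {U : Set M} {ν : M → L4} [IsManifold (𝓡 2) ∞ M]

/-- The unit normal takes the same value at two points of a ruling inside a convex set. -/
theorem normal_add_smul_eq (hR : IsRuledChart f φ c v) (hf : IsSurface ω f)
    (hflat : IsExtrinsicallyFlat f) (hν : IsUnitNormal f U ν) {B : Set E2} (hB : Convex ℝ B)
    (hBU : B ⊆ φ.target ∩ φ.symm ⁻¹' U) {y : E2} {t : ℝ} (hy : y ∈ B)
    (hyt : y + t • coordVec 1 ∈ B) : ν (φ.symm (y + t • coordVec 1)) = ν (φ.symm y) := by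
  have hseg : ∀ r ∈ Set.Icc (0 : ℝ) 1, y + (r * t) • coordVec 1 ∈ B := by
    intro r hr
    have := hB hy hyt (a := 1 - r) (b := r) (by linarith [hr.2]) hr.1 (by ring)
    convert this using 1
    module
  have hder : ∀ r ∈ Set.Icc (0 : ℝ) 1,
      HasDerivAt (fun r : ℝ => ν (φ.symm (y + (r * t) • coordVec 1))) 0 r := by
    intro r hr
    obtain ⟨h1, h2⟩ := hBU (hseg r hr)
    have h3 := hR.hasDerivAt_normal hν h1 h2 1
    rw [hR.normalDeriv_one hf hflat hν h1 h2] at h3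
    have h4 : HasDerivAt (fun r' : ℝ => (r' - r) * t) t r := by
      simpa using ((hasDerivAt_id r).sub_const r).mul_const t
    have h5 : HasDerivAt (fun q : ℝ => ν (φ.symm (y + (r * t) • coordVec 1 + q • coordVec 1))) 0
        ((r - r) * t) := by simpa using h3
    have h6 := h5.scomp r h4
    rw [smul_zero] at h6
    refine h6.congr_of_eventuallyEq (Filter.Eventually.of_forall fun r' => ?_)
    simp only [Function.comp]
    congr 2
    module
  have := constant_of_has_deriv_right_zero
    (fun r hr => (hder r hr).continuousAt.continuousWithinAt)
    (fun r hr => (hder r ⟨hr.1, hr.2.le⟩).hasDerivWithinAt) 1 (by simp)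
  simpa using this

theorem normalDeriv_zero_add_smul (hR : IsRuledChart f φ c v) (hf : IsSurface ω f)
    (hflat : IsExtrinsicallyFlat f) (hν : IsUnitNormal f U ν) {B : Set E2} (hB : Convex ℝ B)
    (hBo : IsOpen B) (hBU : B ⊆ φ.target ∩ φ.symm ⁻¹' U) {y : E2} {t : ℝ} (hy : y ∈ B)
    (hyt : y + t • coordVec 1 ∈ B) :
    normalDeriv ν φ 0 (y + t • coordVec 1) = normalDeriv ν φ 0 y := by
  have h1 := hR.hasDerivAt_normal hν (hBU hy).1 (hBU hy).2 0
  have h2 := hR.hasDerivAt_normal hν (hBU hyt).1 (hBU hyt).2 0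
  refine h2.unique (h1.congr_of_eventuallyEq ?_)
  filter_upwards [eventually_add_smul_mem hBo hy (coordVec 0),
    eventually_add_smul_mem hBo hyt (coordVec 0)] with r hr hr'
  rw [← hR.normal_add_smul_eq hf hflat hν hB hBU (y := y + r • coordVec 0) (t := t) hr
    (by convert hr' using 1; module)]
  congr 2
  module

/-- The kernel of the second fundamental form at a non-umbilic point is the ruling direction. -/
theorem secondForm_eq_zero_iff (hR : IsRuledChart f φ c v) (hf : IsSurface ω f)
    (hflat : IsExtrinsicallyFlat f) (hν : IsUnitNormal f U ν) (hx : x ∈ φ.target)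
    (hU : φ.symm x ∈ U) (hne : normalDeriv ν φ 0 x ≠ 0) (u : TangentSpace (𝓡 2) (φ.symm x)) :
    (∀ w, secondForm f ν (φ.symm x) u w = 0) ↔ ∃ r : ℝ, u = r • chartDeriv φ x (coordVec 1) := by
  have h1 := hR.normalDeriv_one hf hflat hν hx hU
  constructor
  · intro h
    have h0 : diff ν (φ.symm x) u = 0 :=
      (hν.isFrame hf hU).eq_zero (hν.lorentz_diff_point hf hU _)
        (fun w => neg_eq_zero.1 (h w)) (hν.lorentz_diff_normal hU _)
    obtain ⟨w, rfl⟩ := (bijective_chartDeriv hR.mem_atlas hx).2 u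
    have h2 : w 0 • normalDeriv ν φ 0 x + w 1 • normalDeriv ν φ 1 x = 0 := by
      rw [← h0]
      conv_rhs => rw [E2.eq_add w]
      simp only [map_add, map_smul]; rfl
    rw [h1, smul_zero, add_zero] at h2
    have h3 := (smul_eq_zero.1 h2).resolve_right hne
    refine ⟨w 1, ?_⟩
    conv_lhs => rw [E2.eq_add w, h3, zero_smul, zero_add, map_smul]
  · rintro ⟨r, rfl⟩ w
    rw [secondForm, map_smul]
    change -lorentz (r • normalDeriv ν φ 1 x) _ = 0
    rw [h1, smul_zero, lorentz_zero_left, neg_zero]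

theorem isAsymptoticCurve_ruling (hR : IsRuledChart f φ c v) (hf : IsSurface ω f)
    (hflat : IsExtrinsicallyFlat f) (hν : IsUnitNormal f U ν) {I : Set ℝ}
    (hI : IsOpen I) (hI' : I.OrdConnected)
    (hIU : ∀ t ∈ I, x + t • coordVec 1 ∈ φ.target ∩ φ.symm ⁻¹' U)
    (hne : ∀ t ∈ I, normalDeriv ν φ 0 (x + t • coordVec 1) ≠ 0) :
    IsAsymptoticCurve f I (ruling φ x) := by
  have hnu : ∀ t ∈ I, ¬ IsUmbilic f (φ.symm (x + t • coordVec 1)) := by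
    intro t ht
    rw [hν.isUmbilic_iff hf hflat (hIU t ht).2,
      hR.diff_eq_zero_iff hf hflat hν (hIU t ht).1 (hIU t ht).2]
    exact hne t ht
  refine ⟨hI, hI', fun t ht => (contMDiffAt_ruling hR.mem_atlas (hIU t ht).1).contMDiffWithinAt,
    fun t ht => ?_, hnu, fun U' ν' hν' t ht hU' u => ?_⟩
  · rw [velocity_ruling hR.mem_atlas (hIU t ht).1]
    have h := hR.diff_coordVec_one hf (hIU t ht).1
    have h' := (hR.isUnitTangent_ruledT (hIU t ht).1).2.2
    rw [← h] at h'
    exact h'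
  · have hx := (hIU t ht).1
    have hne' : normalDeriv ν' φ 0 (x + t • coordVec 1) ≠ 0 := by
      rw [Ne, ← hR.diff_eq_zero_iff hf hflat hν' hx hU']
      exact fun h => hnu t ht ((hν'.isUmbilic_iff hf hflat hU').2 h)
    rw [velocity_ruling hR.mem_atlas hx]
    exact hR.secondForm_eq_zero_iff hf hflat hν' hx hU' hne' u

/-- If the mean curvature is proportional to `e^t` or `e^{-t}` along the asymptotic curves, then at
a non-umbilic point one of the two null vectors `c ± v` spanned by the ruling is stationary. -/
theorem exists_deriv_add_smul_eq_zero (hR : IsRuledChart f φ c v) (hf : IsSurface ω f)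
    (hexp : IsExponentialType f) (hν : IsUnitNormal f U ν) (hx : x ∈ φ.target)
    (hU : φ.symm x ∈ U) (hne : normalDeriv ν φ 0 x ≠ 0) :
    ∃ σ : ℝ, (σ = 1 ∨ σ = -1) ∧ deriv c (x 0) + σ • deriv v (x 0) = 0 := by
  have hflat := hexp.developable.2
  obtain ⟨r, hr, hB⟩ := Metric.isOpen_iff.1 (φ.symm.isOpen_inter_preimage hν.isOpen) x ⟨hx, hU⟩
  have hmem : ∀ t ∈ Set.Ioo (-r) r, x + t • coordVec 1 ∈ Metric.ball x r := by
    intro t ht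
    rw [Metric.mem_ball, dist_eq_norm, add_sub_cancel_left, norm_smul,
      norm_coordVec, mul_one]
    exact abs_lt.2 ht
  have hconst : ∀ t ∈ Set.Ioo (-r) r,
      normalDeriv ν φ 0 (x + t • coordVec 1) = normalDeriv ν φ 0 x := fun t ht =>
    hR.normalDeriv_zero_add_smul hf hflat hν (convex_ball x r) Metric.isOpen_ball hB
      (Metric.mem_ball_self hr) (hmem t ht)
  have hγ : IsAsymptoticCurve f (Set.Ioo (-r) r) (ruling φ x) :=
    hR.isAsymptoticCurve_ruling hf hflat hν isOpen_Ioo Set.ordConnected_Ioo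
      (fun t ht => hB (hmem t ht)) (fun t ht => by rw [hconst t ht]; exact hne)
  have hH : ∀ t ∈ Set.Ioo (-r) r, normalDeriv ν φ 0 x
      = -(2 * meanCurvature f ν (ruling φ x t)) • (Real.cosh (x 1 + t) • deriv c (x 0)
        + Real.sinh (x 1 + t) • deriv v (x 0)) := by
    intro t ht
    have hm := hB (hmem t ht)
    obtain ⟨k, hk⟩ := hR.exists_normalDeriv_zero_eq hf hflat hν hm.1 hm.2
    have h1 := hR.meanCurvature_eq hf hflat hν hm.1 hm.2 hk
    rw [hconst t ht] at hk
    rw [hk, ruling, h1, mul_div_cancel₀ k two_ne_zero]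
    simp [ruledS]
  have h0 : (0 : ℝ) ∈ Set.Ioo (-r) r := ⟨by linarith, hr⟩
  have h2 : r / 2 ∈ Set.Ioo (-r) r := ⟨by linarith, by linarith⟩
  -- The vector `∂ν/∂s` is constant along the ruling; equating its values at the parameters `0` and
  -- `r / 2` shows that the coefficient of the exponential `e^{2t}` or `e^{-2t}` is zero.
  obtain ⟨C, hC | hC⟩ := hexp.exponential U ν hν _ _ hγ fun t ht => (hB (hmem t ht)).2
  · have key : ∀ t ∈ Set.Ioo (-r) r, normalDeriv ν φ 0 x
        = -C • ((Real.exp (x 1) * (Real.exp t * Real.exp t)) • (deriv c (x 0) + deriv v (x 0))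
          + Real.exp (-x 1) • (deriv c (x 0) - deriv v (x 0))) := by
      intro t ht
      rw [hH t ht, hC t ht, Real.cosh_eq, Real.sinh_eq, neg_add, Real.exp_add, Real.exp_add]
      have e : Real.exp t * Real.exp (-t) = 1 := by rw [← Real.exp_add]; simp
      ext i
      simp only [Pi.add_apply, Pi.sub_apply, Pi.smul_apply, smul_eq_mul]
      linear_combination (-C * Real.exp (-x 1) * (deriv c (x 0) i - deriv v (x 0) i)) * e
    have hC0 : C ≠ 0 := by
      rintro rfl
      exact hne (by rw [key 0 h0]; simp)
    refine ⟨1, Or.inl rfl, ?_⟩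
    have e := (key 0 h0).symm.trans (key _ h2)
    have e' := smul_right_injective L4 (neg_ne_zero.2 hC0) e
    have e'' : (Real.exp (x 1) * (Real.exp (r / 2) * Real.exp (r / 2) - 1)) •
        (deriv c (x 0) + deriv v (x 0)) = 0 := by
      simp only [Real.exp_zero] at e'
      rw [← sub_eq_zero] at e'
      rw [← neg_eq_zero, ← e']
      module
    have hexp1 : 1 < Real.exp (r / 2) := by rw [Real.one_lt_exp_iff]; linarith
    rw [one_smul]
    refine (smul_eq_zero.1 e'').resolve_left (mul_ne_zero (Real.exp_ne_zero _) ?_)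
    nlinarith
  · have key : ∀ t ∈ Set.Ioo (-r) r, normalDeriv ν φ 0 x
        = -C • (Real.exp (x 1) • (deriv c (x 0) + deriv v (x 0))
          + (Real.exp (-x 1) * (Real.exp (-t) * Real.exp (-t))) •
            (deriv c (x 0) - deriv v (x 0))) := by
      intro t ht
      rw [hH t ht, hC t ht, Real.cosh_eq, Real.sinh_eq, neg_add, Real.exp_add, Real.exp_add]
      have e : Real.exp t * Real.exp (-t) = 1 := by rw [← Real.exp_add]; simp
      ext i
      simp only [Pi.add_apply, Pi.sub_apply, Pi.smul_apply, smul_eq_mul]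
      linear_combination (-C * Real.exp (x 1) * (deriv c (x 0) i + deriv v (x 0) i)) * e
    have hC0 : C ≠ 0 := by
      rintro rfl
      exact hne (by rw [key 0 h0]; simp)
    refine ⟨-1, Or.inr rfl, ?_⟩
    have e := (key 0 h0).symm.trans (key _ h2)
    have e' := smul_right_injective L4 (neg_ne_zero.2 hC0) e
    have e'' : (Real.exp (-x 1) * (Real.exp (-(r / 2)) * Real.exp (-(r / 2)) - 1)) •
        (deriv c (x 0) - deriv v (x 0)) = 0 := by
      simp only [neg_zero, Real.exp_zero] at e'
      rw [← sub_eq_zero] at e'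
      rw [← neg_eq_zero, ← e']
      module
    have hexp1 : Real.exp (-(r / 2)) < 1 := by rw [Real.exp_lt_one_iff]; linarith
    have hpos := Real.exp_pos (-(r / 2))
    rw [neg_one_smul, ← sub_eq_add_neg]
    refine (smul_eq_zero.1 e'').resolve_left (mul_ne_zero (Real.exp_ne_zero _) ?_)
    nlinarith

/-- Near a non-umbilic point of a surface of exponential type, there is a null vector `N` that lies
in all the tangent hyperplanes of the cone over the surface. -/
theorem exists_isFutureNull (hR : IsRuledChart f φ c v) (hf : IsSurface ω f)
    (hexp : IsExponentialType f) (hν : IsUnitNormal f U ν) (hx : x ∈ φ.target)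
    (hU : φ.symm x ∈ U) (hne : normalDeriv ν φ 0 x ≠ 0) :
    ∃ N, IsFutureNull N ∧ ∀ᶠ y in 𝓝 x, lorentz N (ν (φ.symm y)) = 0 := by
  obtain ⟨σ, hσ, h0⟩ := hR.exists_deriv_add_smul_eq_zero hf hexp hν hx hU hne
  have hW := (φ.symm.isOpen_inter_preimage hν.isOpen).mem_nhds ⟨hx, hU⟩
  -- the other null vector `c - σ v` is not stationary at `x`, hence not near `x` either
  have hother : deriv c (x 0) - σ • deriv v (x 0) ≠ 0 := by
    intro h1
    have hc : deriv c (x 0) = 0 := by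
      have : (2 : ℝ) • deriv c (x 0) = 0 := by
        rw [← add_zero (0 : L4)]; nth_rewrite 1 [← h0]; rw [← h1]; module
      simpa using this
    have hv : deriv v (x 0) = 0 := by
      rw [hc, zero_add] at h0
      rcases hσ with rfl | rfl <;> simpa using h0
    exact hR.ruledS_ne_zero hf hx (by simp [ruledS, hc, hv])
  have hcont : ContinuousAt (fun y : E2 => deriv c (y 0) - σ • deriv v (y 0)) x :=
    (hR.continuousAt_deriv_curve hx).sub
      ((hR.continuousAt_deriv_field hx).const_smul σ)
  have hev : ∀ᶠ y in 𝓝 x, y ∈ φ.target ∩ φ.symm ⁻¹' U ∧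
      deriv c (y 0) + σ • deriv v (y 0) = 0 := by
    filter_upwards [hW, (continuousAt_normalDeriv hR.mem_atlas hν hx hU 0).eventually_ne hne,
      hcont.eventually_ne hother] with y hy hy1 hy2
    refine ⟨hy, ?_⟩
    obtain ⟨τ, hτ, hτ0⟩ := hR.exists_deriv_add_smul_eq_zero hf hexp hν hy.1 hy.2 hy1
    rcases hσ with rfl | rfl <;> rcases hτ with rfl | rfl
    · exact hτ0
    · exact absurd (by rw [← hτ0]; module) hy2
    · exact absurd (by rw [← hτ0]; module) hy2
    · exact hτ0
  obtain ⟨r, hr, hB⟩ := Metric.eventually_nhds_iff_ball.1 hev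
  refine ⟨c (x 0) + σ • v (x 0), ?_, ?_⟩
  · have h1 := hR.isUnitTangent x hx
    rcases hσ with rfl | rfl
    · rw [one_smul]; exact h1.isFutureNull
    · rw [neg_one_smul]; exact h1.neg.isFutureNull
  · filter_upwards [Metric.ball_mem_nhds x hr] with y hy
    -- `c + σ v` is constant on the interval of the `s`-coordinates of the ball
    have hyeq : c (y 0) + σ • v (y 0) = c (x 0) + σ • v (x 0) := by
      have hmem : ∀ s ∈ Set.Ioo (x 0 - r) (x 0 + r),
          x + (s - x 0) • coordVec 0 ∈ Metric.ball x r := by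
        intro s hs
        rw [Metric.mem_ball, dist_eq_norm, add_sub_cancel_left, norm_smul,
          norm_coordVec, mul_one]
        exact abs_lt.2 ⟨by linarith [hs.1], by linarith [hs.2]⟩
      have hder : ∀ s ∈ Set.Ioo (x 0 - r) (x 0 + r),
          HasDerivAt (fun s => c s + σ • v s) 0 s := by
        intro s hs
        obtain ⟨⟨h1, -⟩, h2⟩ := hB _ (hmem s hs)
        have hc := hR.hasDerivAt_curve h1
        have hv := hR.hasDerivAt_field h1
        have e : (x + (s - x 0) • coordVec 0) 0 = s := by simp
        rw [e] at hc hv h2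
        exact (hc.add (hv.const_smul σ)).congr_deriv h2
      have hy0 : |y 0 - x 0| < r := by
        have h1 := EuclideanSpace.norm_sq_eq (y - x)
        rw [Fin.sum_univ_two] at h1
        rw [Metric.mem_ball, dist_eq_norm] at hy
        have h2 : |y 0 - x 0| ≤ ‖y - x‖ := PiLp.norm_apply_le (y - x) 0
        linarith
      refine isOpen_Ioo.is_const_of_deriv_eq_zero (s := Set.Ioo (x 0 - r) (x 0 + r))
        isPreconnected_Ioo (fun s hs => (hder s hs).differentiableAt.differentiableWithinAt)
        (fun s hs => (hder s hs).deriv) ?_ ?_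
      · exact ⟨by linarith [(abs_lt.1 hy0).1], by linarith [(abs_lt.1 hy0).2]⟩
      · exact ⟨by linarith, by linarith⟩
    obtain ⟨⟨hyt, hyU⟩, -⟩ := hB y hy
    have h1 : lorentz (ν (φ.symm y)) (geod (c (y 0)) (v (y 0)) (y 1)) = 0 := by
      rw [← hR.eq_geod y hyt, lorentz_comm]; exact hν.tangent_H3 _ hyU
    have h2 := (hR.lorentz_normal hf hν hyt hyU).2
    rw [← hyeq, lorentz_comm]
    simp only [geod, ruledT, lorentz_add_right, lorentz_smul_right] at h1 h2 ⊢
    have hcs := Real.cosh_sq (y 1)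
    have hc : lorentz (ν (φ.symm y)) (c (y 0)) = 0 := by
      linear_combination Real.cosh (y 1) * h1 - Real.sinh (y 1) * h2
        - lorentz (ν (φ.symm y)) (c (y 0)) * hcs
    have hv : lorentz (ν (φ.symm y)) (v (y 0)) = 0 := by
      linear_combination -Real.sinh (y 1) * h1 + Real.cosh (y 1) * h2
        - lorentz (ν (φ.symm y)) (v (y 0)) * hcs
    rw [hc, hv]; ring

end IsRuledChart
end Vertex

/-! ### Analytic continuation over the surface -/

/-- The identity principle for a condition that, in each chart, is the vanishing of an analytic
function: on a connected manifold it holds everywhere if it holds on a nonempty open set. -/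
theorem forall_of_eventually_of_analytic [PreconnectedSpace M] {P : M → Prop} {h : M → E2 → ℝ}
    (hh : ∀ q, AnalyticOnNhd ℝ (h q) (chartAt E2 q).target)
    (hP : ∀ q, ∀ x ∈ (chartAt E2 q).target, P ((chartAt E2 q).symm x) ↔ h q x = 0) {p : M}
    (hp : ∀ᶠ q in 𝓝 p, P q) (q : M) : P q := by
  have hclosed : IsClosed {p | ∀ᶠ q in 𝓝 p, P q} := by
    refine isClosed_of_closure_subset fun q hq => ?_
    set ψ := chartAt E2 q
    have hqs : q ∈ ψ.source := mem_chart_source E2 q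
    obtain ⟨r, hr, hB⟩ := Metric.isOpen_iff.1 ψ.open_target (ψ q) (ψ.map_source hqs)
    have hV : ψ.source ∩ ψ ⁻¹' Metric.ball (ψ q) r ∈ 𝓝 q :=
      (ψ.isOpen_inter_preimage Metric.isOpen_ball).mem_nhds ⟨hqs, Metric.mem_ball_self hr⟩
    obtain ⟨p', ⟨hp's, hp'B⟩, hp'⟩ := mem_closure_iff_nhds.1 hq _ hV
    have hz : h q =ᶠ[𝓝 (ψ p')] 0 := by
      have h1 := ψ.symm.continuousAt (x := ψ p') (by simpa using ψ.map_source hp's)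
      rw [ContinuousAt, ψ.left_inv hp's] at h1
      filter_upwards [h1.eventually hp', ψ.open_target.mem_nhds (ψ.map_source hp's)] with y hy hyt
      exact (hP q y hyt).1 hy
    have h0 := ((hh q).mono hB).eqOn_zero_of_preconnected_of_eventuallyEq_zero
      (convex_ball _ _).isPreconnected hp'B hz
    filter_upwards [hV] with y hy
    rw [← ψ.left_inv hy.1]
    exact (hP q _ (ψ.map_source hy.1)).2 (h0 hy.2)
  have huniv := IsClopen.eq_univ ⟨hclosed, isOpen_setOfPred_eventually_nhds⟩ ⟨p, hp⟩
  have : q ∈ {p | ∀ᶠ q in 𝓝 p, P q} := huniv ▸ Set.mem_univ q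
  exact this.self_of_nhds

section Global

variable {f : M → L4} [IsManifold (𝓡 2) ω M]

theorem lorentz_chartCross_eq_zero_iff (hf : IsSurface ω f) {φ : OpenPartialHomeomorph M E2}
    (hφ : φ ∈ IsManifold.maximalAtlas (𝓡 2) ∞ M) {x : E2} (hx : x ∈ φ.target) {U : Set M}
    {ν : M → L4} (hν : IsUnitNormal f U ν) (hU : φ.symm x ∈ U) (N : L4) :
    lorentz N (ν (φ.symm x)) = 0 ↔ lorentz N (chartCross f φ x) = 0 := by
  have h := (hν.isFrame hf hU).eq_smul_normal (x := chartCross f φ x)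
    (lorentz_cross_first _ _ _) (lorentz_chartCross_diff hf hφ hx)
  have hpos := lorentz_chartCross_self_pos hf hφ hx
  have hne : lorentz (chartCross f φ x) (ν (φ.symm x)) ≠ 0 := by
    intro h0
    rw [h, h0, zero_smul, lorentz_zero_left] at hpos
    exact lt_irrefl _ hpos
  rw [h, lorentz_smul_right, mul_eq_zero]
  exact ⟨Or.inr, fun h => h.resolve_left hne⟩

variable [PreconnectedSpace M]

/-- If a vector `N` lies in the span of the position vector and the tangent plane at all points near
`p`, it does so at all points of the surface. -/
theorem forall_lorentz_normal_eq_zero (hf : IsSurface ω f) {N : L4} {U : Set M} {ν : M → L4}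
    (hν : IsUnitNormal f U ν) {p : M} (hp : p ∈ U) (hN : ∀ᶠ q in 𝓝 p, lorentz N (ν q) = 0)
    {U' : Set M} {ν' : M → L4} (hν' : IsUnitNormal f U' ν') {q : M} (hq : q ∈ U') :
    lorentz N (ν' q) = 0 := by
  refine forall_of_eventually_of_analytic
    (P := fun q => ∀ U ν, IsUnitNormal f U ν → q ∈ U → lorentz N (ν q) = 0)
    (h := fun q x => lorentz N (chartCross f (chartAt E2 q) x)) (fun q x hx => ?_)
    (fun q x hx => ?_) (p := p) ?_ q U' ν' hν' hq
  · have h1 : ContDiffAt ℝ ω (chartCross f (chartAt E2 q)) x :=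
      contDiffAt_chartCross (by simp) hf (IsManifold.chart_mem_maximalAtlas q) hx
    exact (contDiffAt_const.lorentz h1).analyticAt
  · have hφ : chartAt E2 q ∈ IsManifold.maximalAtlas (𝓡 2) ∞ M :=
      IsManifold.chart_mem_maximalAtlas q
    constructor
    · intro h
      obtain ⟨U, ν, hν, hU⟩ := exists_isUnitNormal hf ((chartAt E2 q).symm x)
      exact (lorentz_chartCross_eq_zero_iff hf hφ hx hν hU N).1 (h U ν hν hU)
    · intro h U ν hν hU
      exact (lorentz_chartCross_eq_zero_iff hf hφ hx hν hU N).2 h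
  · filter_upwards [hN, hν.isOpen.mem_nhds hp] with y hy hyU V μ hμ hyV
    rcases (hν.eventually_eq_or_eq_neg hf hμ hyU hyV) with h | h
    · rw [h.self_of_nhds, hy]
    · rw [h.self_of_nhds, Pi.neg_apply, lorentz_neg_right, hy, neg_zero]

/-- A surface that is totally geodesic near a point is totally umbilic: it lies in the plane
orthogonal to the normal vector at that point. -/
theorem isUmbilic_of_eventually_diff_eq_zero (hf : IsSurface ω f) {U : Set M} {ν : M → L4}
    (hν : IsUnitNormal f U ν) {p : M} (hp : p ∈ U) (h : ∀ᶠ q in 𝓝 p, diff ν q = 0) (q : M) :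
    IsUmbilic f q := by
  have hconst : ∀ᶠ q in 𝓝 p, ν q = ν p := by
    have hφ : chartAt E2 p ∈ IsManifold.maximalAtlas (𝓡 2) ∞ M :=
      IsManifold.chart_mem_maximalAtlas p
    set ψ := chartAt E2 p
    have hps : p ∈ ψ.source := mem_chart_source E2 p
    have h1 := ψ.symm.continuousAt (x := ψ p) (by simpa using ψ.map_source hps)
    rw [ContinuousAt, ψ.left_inv hps] at h1
    have h2 : ∀ᶠ x in 𝓝 (ψ p), x ∈ ψ.target ∧ ψ.symm x ∈ U ∧ diff ν (ψ.symm x) = 0 :=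
      Filter.Eventually.and (ψ.open_target.mem_nhds (ψ.map_source hps))
        ((h1.eventually (hν.isOpen.mem_nhds hp)).and (h1.eventually h))
    obtain ⟨r, hr, hB⟩ := Metric.eventually_nhds_iff_ball.1 h2
    have hder : ∀ x ∈ Metric.ball (ψ p) r,
        HasFDerivAt (fun y => ν (ψ.symm y)) (0 : E2 →L[ℝ] L4) x := by
      intro x hx
      obtain ⟨hx1, hx2, hx3⟩ := hB x hx
      have := hasFDerivAt_comp_chart_symm hφ hx1 (hν.mdifferentiableAt hx2)
      rw [hx3] at this
      simpa using this
    filter_upwards [(ψ.isOpen_inter_preimage Metric.isOpen_ball).mem_nhds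
      ⟨hps, Metric.mem_ball_self hr⟩] with y hy
    have := Metric.isOpen_ball.is_const_of_fderiv_eq_zero (convex_ball (ψ p) r).isPreconnected
      (fun x hx => (hder x hx).differentiableAt.differentiableWithinAt)
      (fun x hx => (hder x hx).fderiv) hy.2 (Metric.mem_ball_self hr)
    simpa [ψ.left_inv hy.1, ψ.left_inv hps] using this
  have h0 : ∀ q, lorentz (f q) (ν p) = 0 := by
    refine forall_of_eventually_of_analytic
      (h := fun q x => lorentz (f ((chartAt E2 q).symm x)) (ν p)) (fun q x hx => ?_)
      (fun q x hx => Iff.rfl) (p := p) ?_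
    · have h1 : ContDiffAt ℝ ω (fun y => f ((chartAt E2 q).symm y)) x :=
        contDiffAt_comp_chart_symm (IsManifold.chart_mem_maximalAtlas q) hx
          hf.contMDiff.contMDiffAt
      exact (h1.lorentz contDiffAt_const).analyticAt
    · filter_upwards [hconst, hν.isOpen.mem_nhds hp] with y hy hyU
      rw [← hy]; exact hν.tangent_H3 y hyU
  have hd : ∀ q, diff (fun _ : M => ν p) q = 0 := fun q => mfderiv_const
  have hν0 : IsUnitNormal f Set.univ fun _ => ν p := by
    refine ⟨isOpen_univ, contMDiffOn_const, fun q _ => h0 q, fun q _ => hν.unit p hp,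
      fun q _ w => ?_⟩
    have := lorentz_diff_add_lorentz_diff (hf.mdifferentiableAt (by simp) q)
      (mdifferentiableAt_const (c := ν p)) (Filter.Eventually.of_forall h0) w
    rw [hd, lorentz_comm] at this
    simpa [lorentz_zero_right] using this
  refine ⟨_, _, hν0, Set.mem_univ q, 0, ?_⟩
  rw [zero_smul]
  exact (hν0.shapeOperator_eq_zero hf (Set.mem_univ q)).2 (hd q)

/-- A surface of exponential type has a null vector `N` (the vertex) in all its tangent
hyperplanes. -/
theorem exists_vertex (hf : IsSurface ω f) (hexp : IsExponentialType f) :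
    ∃ N, IsFutureNull N ∧ ∀ U ν, IsUnitNormal f U ν → ∀ q ∈ U, lorentz N (ν q) = 0 := by
  obtain ⟨p, hp⟩ := hexp.not_totally_umbilic
  obtain ⟨φ, c, v, hR, hpφ⟩ := hexp.developable.1 p
  obtain ⟨U, ν, hν, hpU⟩ := exists_isUnitNormal hf p
  have hx := φ.map_source hpφ
  have hpx := φ.left_inv hpφ
  have hU : φ.symm (φ p) ∈ U := by rwa [hpx]
  have hne : normalDeriv ν φ 0 (φ p) ≠ 0 := by
    rw [Ne, ← hR.diff_eq_zero_iff hf hexp.developable.2 hν hx hU,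
      ← hν.isUmbilic_iff hf hexp.developable.2 hU, hpx]
    exact hp
  obtain ⟨N, hN, hev⟩ := hR.exists_isFutureNull hf hexp hν hx hU hne
  refine ⟨N, hN, fun U' ν' hν' q hq => forall_lorentz_normal_eq_zero hf hν hpU ?_ hν' hq⟩
  filter_upwards [(φ.continuousAt hpφ).eventually hev, φ.open_source.mem_nhds hpφ] with y hy hys
  rwa [φ.left_inv hys] at hy

variable {N : L4}

namespace IsRuledChart

variable {φ : OpenPartialHomeomorph M E2} {c v : ℝ → L4} {x : E2}

/-- Otherwise, by `⟨N, ∂ν/∂s⟩ = 0`, the unit normal would be stationary near the point. -/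
theorem lorentz_vertex_ruledS (hR : IsRuledChart f φ c v) (hf : IsSurface ω f)
    (hflat : IsExtrinsicallyFlat f) (hnu : ∃ p, ¬ IsUmbilic f p)
    (hN : ∀ U ν, IsUnitNormal f U ν → ∀ q ∈ U, lorentz N (ν q) = 0) (hx : x ∈ φ.target) :
    lorentz N (ruledS c v x) = 0 := by
  by_contra hne
  obtain ⟨p, hp⟩ := hnu
  obtain ⟨U, ν, hν, hU⟩ := exists_isUnitNormal hf (φ.symm x)
  refine hp (isUmbilic_of_eventually_diff_eq_zero hf hν hU ?_ p)
  have hcont : ContinuousAt (fun y => lorentz N (ruledS c v y)) x :=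
    continuous_lorentz.continuousAt.comp (continuousAt_const.prodMk (hR.continuousAt_ruledS hx))
  have hev : ∀ᶠ y in 𝓝 x, diff ν (φ.symm y) = 0 := by
    filter_upwards [hcont.eventually_ne hne,
      (φ.symm.isOpen_inter_preimage hν.isOpen).mem_nhds ⟨hx, hU⟩] with y hy hyU
    have hyt : y ∈ φ.target := hyU.1
    obtain ⟨k, hk⟩ := hR.exists_normalDeriv_zero_eq hf hflat hν hyt hyU.2
    have h1 := ((hasDerivAt_const (0 : ℝ) N).lorentz
      (hR.hasDerivAt_normal hν hyt hyU.2 0)).unique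
      ((hasDerivAt_const (0 : ℝ) (0 : ℝ)).congr_of_eventuallyEq (by
        filter_upwards [eventually_add_smul_mem (φ.symm.isOpen_inter_preimage hν.isOpen) hyU
          (coordVec 0)] with r hr
        exact hN U ν hν _ hr.2))
    rw [lorentz_zero_left, zero_add, hk, lorentz_smul_right] at h1
    have hk0 : -k = 0 := (mul_eq_zero.1 h1).resolve_right hy
    rw [hR.diff_eq_zero_iff hf hflat hν hyt hyU.2, hk, hk0, zero_smul]
  have hs : φ.symm x ∈ φ.source := φ.map_target hx
  have hc := φ.continuousAt hs
  rw [ContinuousAt, φ.right_inv hx] at hc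
  filter_upwards [hc.eventually hev, φ.open_source.mem_nhds hs] with y hy hys
  rwa [φ.left_inv hys] at hy

/-- The rulings point to the vertex or away from it. -/
theorem ruledT_eq_toward (hR : IsRuledChart f φ c v) (hf : IsSurface ω f)
    (hflat : IsExtrinsicallyFlat f) (hnu : ∃ p, ¬ IsUmbilic f p) (hN0 : IsFutureNull N)
    (hN : ∀ U ν, IsUnitNormal f U ν → ∀ q ∈ U, lorentz N (ν q) = 0) (hx : x ∈ φ.target) :
    ruledT c v x = toward N (f (φ.symm x)) ∨ -ruledT c v x = toward N (f (φ.symm x)) := by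
  obtain ⟨U, ν, hν, hU⟩ := exists_isUnitNormal hf (φ.symm x)
  obtain ⟨u, hu⟩ := (hν.isFrame hf hU).exists_eq N
  obtain ⟨u, rfl⟩ := (bijective_chartDeriv hR.mem_atlas hx).2 u
  have hTu : (diff f (φ.symm x)).toLinearMap (chartDeriv φ x u)
      = u 0 • ruledS c v x + u 1 • ruledT c v x := by
    rw [← hR.diff_coordVec_zero hf hx, ← hR.diff_coordVec_one hf hx]
    change diff f _ (chartDeriv φ x u) = _
    conv_lhs => rw [E2.eq_add u]
    simp only [map_add, map_smul]
  -- `N = -⟨N, f⟩ f + u₀ ∂f/∂s + u₁ ∂f/∂t`, where `u₀ = 0`, and `u₁ = ±⟨N, f⟩` as `N` is null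
  rw [hTu, hN U ν hν _ hU, zero_smul, add_zero] at hu
  have hUT := hR.isUnitTangent_ruledT hx
  have hS := hR.lorentz_vertex_ruledS hf hflat hnu hN hx
  have hSa : lorentz (ruledS c v x) (f (φ.symm x)) = 0 := by
    rw [← hR.diff_coordVec_zero hf hx, lorentz_comm]; exact hf.lorentz_diff _ _
  have hSS := lorentz_self_pos (hf.mem_H3 _) hSa (hR.ruledS_ne_zero hf hx)
  have hST := hR.lorentz_ruledS_ruledT hx
  set a := f (φ.symm x)
  set S := ruledS c v x
  set T := ruledT c v x
  have hm := hN0.lorentz_neg (hf.mem_H3 (φ.symm x))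
  change lorentz N a < 0 at hm
  set m := lorentz N a
  have hu0 : u 0 = 0 := by
    rw [hu] at hS
    simp only [lorentz_add_left, lorentz_smul_left, lorentz_comm a S, lorentz_comm T S, hSa,
      hST] at hS
    have : u 0 * lorentz S S = 0 := by linarith
    exact (mul_eq_zero.1 this).resolve_right hSS.ne'
  rw [hu0, zero_smul, zero_add] at hu
  have hnull := hN0.1
  rw [hu] at hnull
  simp only [lorentz_add_left, lorentz_add_right, lorentz_smul_left, lorentz_smul_right,
    lorentz_comm T a, hUT.2.1, hUT.2.2, hUT.1.1] at hnull
  have hsq : (u 1 - m) * (u 1 + m) = 0 := by linarith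
  rcases mul_eq_zero.1 hsq with h | h
  · right
    refine eq_toward hUT.neg (r := (-m)⁻¹) ?_
    have : u 1 = m := by linarith
    rw [hu, this, smul_add, smul_smul, smul_smul, inv_mul_cancel₀ (by linarith : -m ≠ 0)]
    have : (-m)⁻¹ * m = -1 := by field_simp [hm.ne]
    rw [this]; module
  · left
    refine eq_toward hUT (r := (-m)⁻¹) ?_
    have : u 1 = -m := by linarith
    rw [hu, this, smul_add, smul_smul, smul_smul, inv_mul_cancel₀ (by linarith : -m ≠ 0)]
    module

end IsRuledChart
end Global

/-! ### Ruled coordinates directed to the vertex -/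

/-- The reflection `(s, t) ↦ (s, -t)` of the coordinate plane. -/
def reflect : E2 ≃L[ℝ] E2 :=
  (LinearEquiv.ofInvolutive
    (LinearMap.id - (2 : ℝ) • (EuclideanSpace.proj (1 : Fin 2) : E2 →L[ℝ] ℝ).toLinearMap.smulRight
      (coordVec 1)) (fun w => by
      ext i; fin_cases i <;> simp; ring)).toContinuousLinearEquiv

theorem reflect_apply (w : E2) : reflect w = w - (2 : ℝ) • (w 1 • coordVec 1) := rfl

@[simp] theorem reflect_apply_zero (w : E2) : reflect w 0 = w 0 := by
  simp [reflect_apply]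

@[simp] theorem reflect_apply_one (w : E2) : reflect w 1 = -w 1 := by
  simp [reflect_apply]; ring

section Directed

variable {f : M → L4} {φ : OpenPartialHomeomorph M E2} {c v : ℝ → L4}

theorem IsRuledChart.reflect [IsManifold (𝓡 2) ∞ M] (hR : IsRuledChart f φ c v) :
    IsRuledChart f (φ.transHomeomorph reflect.toHomeomorph) c (-v) := by
  have hmem : ∀ x ∈ (φ.transHomeomorph HypSurf.reflect.toHomeomorph).target,
      HypSurf.reflect x ∈ φ.target := fun x hx => hx
  have hsymm : ∀ x, (φ.transHomeomorph HypSurf.reflect.toHomeomorph).symm x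
      = φ.symm (HypSurf.reflect x) := fun x => rfl
  refine ⟨?_, fun x hx => ?_, fun x hx => ?_, fun x hx => ?_, fun x hx => ?_, fun x hx => ?_⟩
  · refine OpenPartialHomeomorph.mem_maximalAtlas_of_contMDiffOn _ ?_ ?_
    · exact HypSurf.reflect.contDiff.contMDiff.comp_contMDiffOn
        (contMDiffOn_of_mem_maximalAtlas hR.mem_atlas)
    · exact (contMDiffOn_symm_of_mem_maximalAtlas hR.mem_atlas).comp
        HypSurf.reflect.contDiff.contMDiff.contMDiffOn fun x hx => hx
  · simpa using hR.contDiffAt_curve _ (hmem x hx)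
  · have h := (hR.contDiffAt_field _ (hmem x hx)).neg
    rw [reflect_apply_zero] at h
    exact h
  · simpa using (hR.isUnitTangent _ (hmem x hx)).neg
  · simpa [lorentz_neg_right] using hR.normal _ (hmem x hx)
  · rw [hsymm, hR.eq_geod _ (hmem x hx), reflect_apply_zero, reflect_apply_one, Pi.neg_apply,
      geod_neg]

theorem IsRuledChart.restrict [IsManifold (𝓡 2) ∞ M] (hR : IsRuledChart f φ c v) {W : Set E2}
    (hW : IsOpen W) : IsRuledChart f (φ.symm.restrOpen W hW).symm c v := by
  have hmem : ∀ x ∈ (φ.symm.restrOpen W hW).symm.target, x ∈ φ.target := fun x hx => hx.1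
  refine ⟨?_, fun x hx => hR.contDiffAt_curve x (hmem x hx),
    fun x hx => hR.contDiffAt_field x (hmem x hx), fun x hx => hR.isUnitTangent x (hmem x hx),
    fun x hx => hR.normal x (hmem x hx), fun x hx => hR.eq_geod x (hmem x hx)⟩
  refine OpenPartialHomeomorph.mem_maximalAtlas_of_contMDiffOn _ ?_ ?_
  · exact (contMDiffOn_of_mem_maximalAtlas hR.mem_atlas).mono fun x hx => hx.1
  · exact (contMDiffOn_symm_of_mem_maximalAtlas hR.mem_atlas).mono fun x hx => hx.1

variable {N : L4}

theorem lorentz_toward (hN : IsFutureNull N) (y : L4) : lorentz N (toward N y) = -lorentz N y := by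
  rw [toward, lorentz_sub_right, lorentz_smul_right, hN.1]; ring

/-- Around each point there are ruled coordinates whose `t`-lines all run to the ideal point `N`. -/
def IsDirectedTo (f : M → L4) (N : L4) : Prop :=
  ∀ p : M, ∃ φ c v, IsRuledChart f φ c v ∧ p ∈ φ.source ∧
    ∀ x ∈ φ.target, ruledT c v x = toward N (f (φ.symm x))

/-- The rulings of a developable surface that has `N` in all its tangent hyperplanes can be directed
to `N` in a consistent way: each of them runs to `N` or away from it, and in the latter case its
parameter is reversed. -/
theorem isDirectedTo [IsManifold (𝓡 2) ω M] [PreconnectedSpace M]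
    (hf : IsSurface ω f) (hdev : IsDevelopable f) (hnu : ∃ p, ¬ IsUmbilic f p)
    (hN0 : IsFutureNull N) (hN : ∀ U ν, IsUnitNormal f U ν → ∀ q ∈ U, lorentz N (ν q) = 0) :
    IsDirectedTo f N := by
  intro p
  obtain ⟨φ, c, v, hR, hp, hpos⟩ : ∃ φ c v, IsRuledChart f φ c v ∧ p ∈ φ.source ∧
      ruledT c v (φ p) = toward N (f p) := by
    obtain ⟨φ, c, v, hR, hp⟩ := hdev.1 p
    have h := hR.ruledT_eq_toward hf hdev.2 hnu hN0 hN (φ.map_source hp)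
    rw [φ.left_inv hp] at h
    rcases h with h | h
    · exact ⟨φ, c, v, hR, hp, h⟩
    · refine ⟨_, _, _, hR.reflect, by simpa using hp, ?_⟩
      rw [← h]
      simp [ruledT]
      module
  -- where `⟨N, ∂f/∂t⟩` is positive, which is an open condition, the rulings run to `N`
  have hcont : ContinuousOn (fun x => lorentz N (ruledT c v x)) φ.target := fun x hx =>
    (continuous_lorentz.continuousAt.comp
      (continuousAt_const.prodMk (hR.continuousAt_ruledT hx))).continuousWithinAt
  have hWo := hcont.isOpen_inter_preimage φ.open_target (isOpen_Ioi (a := (0 : ℝ)))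
  have hneg (q : M) := hN0.lorentz_neg (hf.mem_H3 q)
  refine ⟨_, c, v, hR.restrict hWo, ?_, ?_⟩
  · refine ⟨hp, φ.map_source hp, ?_⟩
    change 0 < lorentz N (ruledT c v (φ p))
    rw [hpos, lorentz_toward hN0]
    linarith [hneg p]
  · rintro x ⟨hx, -, hx0⟩
    refine (hR.ruledT_eq_toward hf hdev.2 hnu hN0 hN hx).resolve_right fun h => ?_
    change 0 < lorentz N (ruledT c v x) at hx0
    rw [← neg_neg (ruledT c v x), h, lorentz_neg_right, lorentz_toward hN0] at hx0
    linarith [hneg (φ.symm x)]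

/-- A ruling that runs to `N` at one of its points has its base vectors `c`, `v` with `c + v` on the
ray of `N`. -/
theorem add_eq_smul_of_ruledT_eq (hR : IsRuledChart f φ c v) {x : E2} (hx : x ∈ φ.target)
    (h : ruledT c v x = toward N (f (φ.symm x))) :
    c (x 0) + v (x 0) = (Real.exp (-x 1) * (-lorentz N (f (φ.symm x)))⁻¹) • N := by
  have h1 := geod_add_velocity (c (x 0)) (v (x 0)) (x 1)
  rw [← hR.eq_geod x hx] at h1
  rw [mul_smul, ← add_toward, ← h, ruledT, h1, smul_smul, ← Real.exp_add]
  simp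

end Directed

/-! ### Lifting geodesics to the surface -/

section Lifts

variable {f : M → L4} {N : L4}

/-- An immersion is locally injective: a linear left inverse of its differential turns it into a map
to which the inverse function theorem applies. -/
theorem isLocallyInjective [IsManifold (𝓡 2) ∞ M] (hf : IsSurface ω f) : IsLocallyInjective f := by
  rw [isLocallyInjective_iff_nhds]
  intro q
  have hφ : chartAt E2 q ∈ IsManifold.maximalAtlas (𝓡 2) ∞ M := IsManifold.chart_mem_maximalAtlas q
  set φ := chartAt E2 q
  have hq : q ∈ φ.source := mem_chart_source E2 q
  have hx := φ.map_source hq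
  have h1 : ContDiffAt ℝ ∞ (fun y => f (φ.symm y)) (φ q) :=
    contDiffAt_comp_chart_symm hφ hx (hf.contMDiff.contMDiffAt.of_le le_top)
  have h2 := h1.hasStrictFDerivAt (by simp)
  rw [fderiv_comp_chart_symm hf hφ hx] at h2
  set T := (diff f (φ.symm (φ q))).comp (chartDeriv φ (φ q))
  have hT : LinearMap.ker T.toLinearMap = ⊥ :=
    LinearMap.ker_eq_bot.2 ((hf.injective_diff _).comp (bijective_chartDeriv hφ hx).1)
  obtain ⟨P, hP⟩ := LinearMap.exists_leftInverse_of_injective T.toLinearMap hT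
  have h3 : HasStrictFDerivAt (fun y => LinearMap.toContinuousLinearMap P (f (φ.symm y)))
      ((ContinuousLinearEquiv.refl ℝ E2 : E2 ≃L[ℝ] E2) : E2 →L[ℝ] E2) (φ q) := by
    refine ((LinearMap.toContinuousLinearMap P).hasStrictFDerivAt.comp (φ q) h2).congr_fderiv ?_
    ext1 w
    exact LinearMap.congr_fun hP w
  have h4 := h3.eventually_left_inverse
  have h5 := (φ.continuousAt hq).eventually h4
  refine ⟨_, h5.and (φ.open_source.mem_nhds hq), ?_⟩
  rintro y ⟨hy, hys⟩ z ⟨hz, hzs⟩ hyz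
  refine φ.injOn hys hzs ?_
  rw [← hy, ← hz, φ.left_inv hys, φ.left_inv hzs, hyz]

/-- `γ` is of class `C¹` on the set of parameters `D`, starts at `p`, and `f ∘ γ = G` on `D`. -/
structure IsLift (f : M → L4) (G : ℝ → L4) (p : M) (D : Set ℝ) (γ : ℝ → M) : Prop where
  contMDiffAt : ∀ t ∈ D, ContMDiffAt 𝓘(ℝ, ℝ) (𝓡 2) 1 γ t
  map_zero : γ 0 = p
  map_eq : ∀ t ∈ D, f (γ t) = G t

variable {G : ℝ → L4} {p : M}

theorem IsLift.mono {D D' : Set ℝ} {γ : ℝ → M} (h : IsLift f G p D γ) (hD : D' ⊆ D) :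
    IsLift f G p D' γ :=
  ⟨fun t ht => h.contMDiffAt t (hD ht), h.map_zero, fun t ht => h.map_eq t (hD ht)⟩

theorem IsLift.continuousOn {D : Set ℝ} {γ : ℝ → M} (h : IsLift f G p D γ) : ContinuousOn γ D :=
  fun t ht => (h.contMDiffAt t ht).continuousAt.continuousWithinAt

theorem hasDerivAt_comp_curve (hf : IsSurface ω f) {γ : ℝ → M} {t : ℝ}
    (hγ : MDifferentiableAt 𝓘(ℝ, ℝ) (𝓡 2) γ t) :
    HasDerivAt (fun s => f (γ s)) (diff f (γ t) (velocity γ t)) t := by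
  have h := (hf.mdifferentiableAt (by simp) (γ t)).hasMFDerivAt.comp t hγ.hasMFDerivAt
  have h' : HasFDerivAt (fun s => f (γ s)) ((diff f (γ t)).comp
      (mfderiv 𝓘(ℝ, ℝ) (𝓡 2) γ t : ℝ →L[ℝ] TangentSpace (𝓡 2) (γ t))) t := h.hasFDerivAt
  exact h'.hasDerivAt

/-- Rulings have unit speed, so the induced distance of their points is at most the difference of
the parameters. -/
theorem inducedEDist_le (hf : IsSurface ω f) {P V : L4} (hPV : IsUnitTangent P V) {D : Set ℝ}
    {γ : ℝ → M} (hγ : IsLift f (geod P V) p D γ) (hD : IsOpen D) {a b : ℝ}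
    (hab : Set.uIcc a b ⊆ D) : inducedEDist f (γ a) (γ b) ≤ edist a b := by
  unfold inducedEDist
  let _ : ∀ x : M, ENorm (TangentSpace (𝓡 2) x) :=
    fun x => ⟨fun v => ENNReal.ofReal (Real.sqrt (firstForm f x v v))⟩
  have : ∀ x : M, ENormSMulClass ℝ (TangentSpace (𝓡 2) x) := fun x => ⟨fun r v => by
    change ENNReal.ofReal (Real.sqrt (firstForm f x (r • v) (r • v)))
      = ‖r‖ₑ * ENNReal.ofReal (Real.sqrt (firstForm f x v v))
    have e : firstForm f x (r • v) (r • v) = r ^ 2 * firstForm f x v v := by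
      simp only [firstForm, map_smul, lorentz_smul_left, lorentz_smul_right]; ring
    rw [e, Real.sqrt_mul (sq_nonneg r), Real.sqrt_sq_eq_abs, ENNReal.ofReal_mul (abs_nonneg r),
      Real.enorm_eq_ofReal_abs]⟩
  have key : ∀ a b : ℝ, a ≤ b → Set.Icc a b ⊆ D →
      Manifold.riemannianEDist (𝓡 2) (γ a) (γ b) ≤ edist a b := by
    intro a b hab hD'
    refine (Manifold.riemannianEDist_le_pathELength (I := 𝓡 2) (γ := γ)
      (fun t ht => (hγ.contMDiffAt t (hD' ht)).contMDiffWithinAt) rfl rfl hab).trans ?_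
    rw [Manifold.pathELength_eq_lintegral_mfderiv_Icc]
    have h1 : ∀ t ∈ Set.Icc a b, ‖mfderiv 𝓘(ℝ, ℝ) (𝓡 2) γ t (1 : ℝ)‖ₑ = 1 := by
      intro t ht
      have h2 := (hasDerivAt_comp_curve hf
        ((hγ.contMDiffAt t (hD' ht)).mdifferentiableAt (by simp))).unique
        ((hasDerivAt_geod P V t).congr_of_eventuallyEq (by
          filter_upwards [hD.mem_nhds (hD' ht)] with s hs using hγ.map_eq s hs))
      have h3 : firstForm f (γ t) (velocity γ t) (velocity γ t) = 1 := by
        rw [firstForm, h2]; exact (hPV.velocity_geod t).2.2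
      change ENNReal.ofReal (Real.sqrt (firstForm f (γ t) (velocity γ t) (velocity γ t))) = 1
      rw [h3]; simp
    refine (MeasureTheory.setLIntegral_congr_fun measurableSet_Icc h1).trans_le ?_
    rw [MeasureTheory.setLIntegral_one,
      Real.volume_Icc, edist_dist, Real.dist_eq, abs_sub_comm, abs_of_nonneg (by linarith)]
  rcases le_total a b with h | h
  · exact key a b h (by rwa [Set.uIcc_of_le h] at hab)
  · rw [Manifold.riemannianEDist_comm, edist_comm]
    exact key b a h (by rwa [Set.uIcc_of_ge h] at hab)

variable [T2Space M] [IsManifold (𝓡 2) ∞ M]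

/-- Lifts that agree somewhere on an interval agree on it, as `f` is locally injective. -/
theorem IsLift.eqOn (hf : IsSurface ω f) {p' : M} {G' : ℝ → L4} {D D' I : Set ℝ} {γ γ' : ℝ → M}
    (h : IsLift f G p D γ) (h' : IsLift f G' p' D' γ') (hI : IsPreconnected I)
    (hID : I ⊆ D) (hID' : I ⊆ D') (hG : ∀ t ∈ I, G t = G' t) {t : ℝ} (ht : t ∈ I)
    (htt : γ t = γ' t) : Set.EqOn γ γ' I :=
  (T2Space.isSeparatedMap f).eqOn_of_comp_eqOn (isLocallyInjective hf) hI (h.continuousOn.mono hID)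
    (h'.continuousOn.mono hID')
    (fun s hs => by simp [h.map_eq s (hID hs), h'.map_eq s (hID' hs), hG s hs]) ht htt

/-- Lifts over the intervals `(a, b)`, `b ∈ A`, are glued to a lift over their union. -/
theorem exists_isLift_of_forall (hf : IsSurface ω f) {a : ℝ} (ha : a < 0) {A : Set ℝ}
    (hA : A.Nonempty) (hA0 : ∀ b ∈ A, 0 < b) (h : ∀ b ∈ A, ∃ γ, IsLift f G p (Set.Ioo a b) γ) :
    ∃ γ, IsLift f G p {t | a < t ∧ ∃ b ∈ A, t < b} γ := by
  classical
  have : Nonempty (ℝ → M) := ⟨fun _ => p⟩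
  choose! γ hγ using h
  obtain ⟨b0, hb0⟩ := hA
  let B : ℝ → ℝ := fun t => if h : ∃ b ∈ A, t < b then h.choose else b0
  have hB : ∀ t, (∃ b ∈ A, t < b) → B t ∈ A ∧ t < B t := by
    intro t ht
    simp only [B, dif_pos ht]
    exact ht.choose_spec
  have key : ∀ b ∈ A, ∀ t ∈ Set.Ioo a b, γ (B t) t = γ b t := by
    rintro b hb t ⟨hat, htb⟩
    obtain ⟨h1, h2⟩ := hB t ⟨b, hb, htb⟩
    refine (hγ _ h1).eqOn hf (hγ b hb) (I := Set.Ioo a (min (B t) b)) isPreconnected_Ioo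
      (Set.Ioo_subset_Ioo_right (min_le_left _ _)) (Set.Ioo_subset_Ioo_right (min_le_right _ _))
      (fun _ _ => rfl) (t := 0) ⟨ha, lt_min (hA0 _ h1) (hA0 b hb)⟩ ?_ ⟨hat, lt_min h2 htb⟩
    rw [(hγ _ h1).map_zero, (hγ b hb).map_zero]
  refine ⟨fun t => γ (B t) t, ?_, ?_, ?_⟩
  · rintro t ⟨hat, b, hb, htb⟩
    refine ((hγ b hb).contMDiffAt t ⟨hat, htb⟩).congr_of_eventuallyEq ?_
    filter_upwards [Ioo_mem_nhds hat htb] with s hs using key b hb s hs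
  · exact (key b0 hb0 0 ⟨ha, hA0 b0 hb0⟩).trans (hγ b0 hb0).map_zero
  · rintro t ⟨hat, b, hb, htb⟩
    rw [key b hb t ⟨hat, htb⟩, (hγ b hb).map_eq t ⟨hat, htb⟩]

end Lifts

section Complete

variable {f : M → L4} {N : L4}

/-- Rulings are local lifts of the geodesics that run to the vertex or away from it. -/
theorem exists_isLift_near (hdir : IsDirectedTo f N) {σ : ℝ} (hσ : σ = 1 ∨ σ = -1) (p : M) :
    ∃ δ > 0, ∃ γ, IsLift f (geod (f p) (σ • toward N (f p))) p (Set.Ioo (-δ) δ) γ := by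
  obtain ⟨φ, c, v, hR, hp, hT⟩ := hdir p
  have hx := φ.map_source hp
  obtain ⟨δ, hδ, hB⟩ := Metric.isOpen_iff.1 φ.open_target (φ p) hx
  have hmem : ∀ t ∈ Set.Ioo (-δ) δ, φ p + (σ * t) • coordVec 1 ∈ φ.target := by
    intro t ht
    refine hB ?_
    rw [Metric.mem_ball, dist_eq_norm, add_sub_cancel_left, norm_smul, norm_coordVec, mul_one,
      norm_mul]
    have : ‖σ‖ = 1 := by rcases hσ with rfl | rfl <;> simp
    rw [this, one_mul]
    exact abs_lt.2 ht
  refine ⟨δ, hδ, fun t => ruling φ (φ p) (σ * t), fun t ht => ?_, ?_, fun t ht => ?_⟩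
  · refine ContMDiffAt.comp (g := ruling φ (φ p)) (f := fun t => σ * t) t
      ((contMDiffAt_ruling hR.mem_atlas (hmem t ht)).of_le ENat.LEInfty.out) ?_
    refine ContDiffAt.contMDiffAt ?_
    fun_prop
  · simp [ruling, φ.left_inv hp]
  · have h1 := hR.eq_geod _ hx
    have h2 := hT _ hx
    rw [φ.left_inv hp] at h1 h2
    rw [ruling, hR.eq_geod _ (hmem t ht), ← h2, h1]
    have e0 : (φ p + (σ * t) • coordVec 1) 0 = φ p 0 := by simp
    have e1 : (φ p + (σ * t) • coordVec 1) 1 = φ p 1 + σ * t := by simp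
    rw [e0, e1, geod_add]
    rcases hσ with rfl | rfl
    · simp [ruledT]
    · rw [neg_one_smul, geod_neg]; simp [ruledT]

theorem geod_toward_add (hN : IsFutureNull N) {y : L4} (hy : y ∈ H3) {σ : ℝ} (hσ : σ = 1 ∨ σ = -1)
    (t s : ℝ) : geod y (σ • toward N y) (t + s) = geod (geod y (σ • toward N y) t)
      (σ • toward N (geod y (σ • toward N y) t)) s := by
  rw [geod_add, velocity_geod_toward hN hy hσ]

variable [IsManifold (𝓡 2) ω M] [T2Space M]

/-- By completeness, a ruling can be continued beyond any finite length. -/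
theorem exists_isLift_extension (hf : IsSurface ω f) (hcomp : IsCompleteSurface f)
    (hN : IsFutureNull N) (hdir : IsDirectedTo f N) {σ : ℝ} (hσ : σ = 1 ∨ σ = -1) {p : M} {a b : ℝ}
    (ha : a < 0) (hb : 0 < b) {γ : ℝ → M}
    (hγ : IsLift f (geod (f p) (σ • toward N (f p))) p (Set.Ioo a b) γ) :
    ∃ δ > 0, ∃ γ', IsLift f (geod (f p) (σ • toward N (f p))) p (Set.Ioo a (b + δ)) γ' := by
  have hu : IsUnitTangent (f p) (σ • toward N (f p)) := by
    have h := hN.isUnitTangent_toward (hf.mem_H3 p)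
    rcases hσ with rfl | rfl
    · rwa [one_smul]
    · rw [neg_one_smul]; exact h.neg
  set G := geod (f p) (σ • toward N (f p))
  have hGc : Continuous G :=
    continuous_iff_continuousAt.2 fun t => (hasDerivAt_geod _ _ t).continuousAt
  -- a sequence of points of the ruling that approaches its end
  obtain ⟨τ, -, hτ, hτb⟩ := exists_seq_strictMono_tendsto' hb
  have hτD : ∀ n, τ n ∈ Set.Ioo a b := fun n => ⟨ha.trans (hτ n).1, (hτ n).2⟩
  obtain ⟨q, hq⟩ := hcomp (fun n => γ (τ n)) (by
    intro ε hε
    obtain ⟨n0, hn0⟩ := EMetric.cauchySeq_iff.1 hτb.cauchySeq ε hε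
    refine ⟨n0, fun m hm n hn => ?_⟩
    exact (inducedEDist_le hf hu hγ isOpen_Ioo
      (Set.ordConnected_Ioo.uIcc_subset (hτD m) (hτD n))).trans_lt (hn0 m hm n hn))
  have hfq : f q = G b := by
    refine tendsto_nhds_unique ((hf.contMDiff.continuous.tendsto q).comp hq) ?_
    refine ((hGc.tendsto b).comp hτb).congr fun n => ?_
    exact (hγ.map_eq _ (hτD n)).symm
  obtain ⟨δ, hδ, γq, hγq⟩ := exists_isLift_near hdir hσ q
  have hGq (t : ℝ) : geod (f q) (σ • toward N (f q)) t = G (b + t) := by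
    rw [hfq]; exact (geod_toward_add hN (hf.mem_H3 p) hσ b t).symm
  -- the local ruling through the limit point, with the parameter shifted
  have hγq' : IsLift f G (γq (0 - b)) (Set.Ioo (b - δ) (b + δ)) fun t => γq (t - b) := by
    have hmem : ∀ t ∈ Set.Ioo (b - δ) (b + δ), t - b ∈ Set.Ioo (-δ) δ := fun t ht =>
      ⟨by linarith [ht.1], by linarith [ht.2]⟩
    refine ⟨fun t ht => ?_, rfl, fun t ht => ?_⟩
    · refine ContMDiffAt.comp t (hγq.contMDiffAt _ (hmem t ht)) ?_
      refine ContDiffAt.contMDiffAt ?_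
      fun_prop
    · rw [hγq.map_eq _ (hmem t ht), hGq]
      congr 1; ring
  -- both curves meet, as `f` is injective near the limit point
  obtain ⟨n, hn, hnδ⟩ : ∃ n, γ (τ n) = γq (τ n - b) ∧ b - δ < τ n := by
    obtain ⟨V, hV, hinj⟩ := isLocallyInjective_iff_nhds.1 (isLocallyInjective hf) q
    have h1 : Filter.Tendsto (fun n => γq (τ n - b)) Filter.atTop (𝓝 q) := by
      have h2 := (hγq'.contMDiffAt b ⟨by linarith, by linarith⟩).continuousAt.tendsto.comp hτb
      simpa [hγq.map_zero, Function.comp_def] using h2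
    have h3 := hτb.eventually (lt_mem_nhds (sub_lt_self b hδ))
    obtain ⟨n, hn1, hn2, hn3⟩ := ((hq.eventually hV).and ((h1.eventually hV).and h3)).exists
    refine ⟨n, hinj hn1 hn2 ?_, hn3⟩
    rw [hγ.map_eq _ (hτD n)]
    exact (hγq'.map_eq (τ n) ⟨hn3, by linarith [(hτ n).2]⟩).symm
  have hEq : Set.EqOn γ (fun t => γq (t - b)) (Set.Ioo (max a (b - δ)) b) :=
    hγ.eqOn hf hγq' isPreconnected_Ioo (Set.Ioo_subset_Ioo_left (le_max_left _ _))
      (Set.Ioo_subset_Ioo (le_max_right _ _) (by linarith)) (fun _ _ => rfl)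
      (t := τ n) ⟨max_lt (hτD n).1 hnδ, (hτ n).2⟩ hn
  refine ⟨δ, hδ, fun t => if t < b then γ t else γq (t - b), fun t ht => ?_, ?_, fun t ht => ?_⟩
  · rcases lt_or_ge t b with h | h
    · refine (hγ.contMDiffAt t ⟨ht.1, h⟩).congr_of_eventuallyEq ?_
      filter_upwards [gt_mem_nhds h] with s hs using if_pos hs
    · have hbδ : b - δ < t := by linarith
      refine (hγq'.contMDiffAt t ⟨hbδ, ht.2⟩).congr_of_eventuallyEq ?_
      filter_upwards [lt_mem_nhds (max_lt ht.1 hbδ)] with s hs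
      split_ifs with h'
      · exact hEq ⟨hs, h'⟩
      · rfl
  · simp [hb, hγ.map_zero]
  · split_ifs with h
    · exact hγ.map_eq t ⟨ht.1, h⟩
    · exact hγq'.map_eq t ⟨by linarith [not_lt.1 h], ht.2⟩

/-- Completeness makes the rulings half-lines: the supremum of the end points of the intervals with
a lift cannot be finite, as the lifts over shorter intervals fit together and can be extended. -/
theorem exists_isLift_half_line (hf : IsSurface ω f) (hcomp : IsCompleteSurface f)
    (hN : IsFutureNull N) (hdir : IsDirectedTo f N) {σ : ℝ} (hσ : σ = 1 ∨ σ = -1) (p : M) :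
    ∃ a < 0, ∃ γ, IsLift f (geod (f p) (σ • toward N (f p))) p (Set.Ioi a) γ := by
  obtain ⟨δ, hδ, γ0, hγ0⟩ := exists_isLift_near hdir hσ p
  set G := geod (f p) (σ • toward N (f p))
  set A : Set ℝ := {b | 0 < b ∧ ∃ γ, IsLift f G p (Set.Ioo (-δ) b) γ}
  have hδA : δ ∈ A := ⟨hδ, γ0, hγ0⟩
  obtain ⟨γ, hγ⟩ := exists_isLift_of_forall hf (neg_lt_zero.2 hδ) ⟨δ, hδA⟩ (fun b hb => hb.1)
    (fun b hb => hb.2)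
  have hA : ¬ BddAbove A := by
    intro hbdd
    have hpos : 0 < sSup A := hδ.trans_le (le_csSup hbdd hδA)
    have h1 : IsLift f G p (Set.Ioo (-δ) (sSup A)) γ := hγ.mono fun t ht =>
      ⟨ht.1, exists_lt_of_lt_csSup ⟨δ, hδA⟩ ht.2⟩
    obtain ⟨ε, hε, γ', hγ'⟩ :=
      exists_isLift_extension hf hcomp hN hdir hσ (neg_lt_zero.2 hδ) hpos h1
    have := le_csSup hbdd (show sSup A + ε ∈ A from ⟨by linarith, γ', hγ'⟩)
    linarith
  refine ⟨-δ, neg_lt_zero.2 hδ, γ, hγ.mono fun t ht => ⟨ht, ?_⟩⟩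
  obtain ⟨b, hb, htb⟩ := not_bddAbove_iff.1 hA t
  exact ⟨b, hb, htb⟩

/-- The whole geodesic from a point of the surface to the vertex lies in the surface. -/
theorem exists_complete_ruling (hf : IsSurface ω f) (hcomp : IsCompleteSurface f)
    (hN : IsFutureNull N) (hdir : IsDirectedTo f N) (p : M) :
    ∃ γ : ℝ → M, Continuous γ ∧ γ 0 = p ∧ ∀ t, f (γ t) = geod (f p) (toward N (f p)) t := by
  obtain ⟨a, ha, γ, hγ⟩ := exists_isLift_half_line hf hcomp hN hdir (Or.inl rfl : (1 : ℝ) = 1 ∨ _) p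
  obtain ⟨a', ha', γ', hγ'⟩ :=
    exists_isLift_half_line hf hcomp hN hdir (Or.inr rfl : (-1 : ℝ) = 1 ∨ _) p
  refine ⟨fun t => if 0 ≤ t then γ t else γ' (-t), ?_, by simp [hγ.map_zero], fun t => ?_⟩
  · have h1 : ContinuousOn γ (Set.Ici 0) :=
      hγ.continuousOn.mono fun t ht => ha.trans_le ht
    have h2 : ContinuousOn (fun t => γ' (-t)) (Set.Iic 0) :=
      hγ'.continuousOn.comp continuous_neg.continuousOn fun t ht => by
        have : t ≤ 0 := ht
        exact lt_of_lt_of_le ha' (by linarith)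
    exact continuous_if_le continuous_const continuous_id h1 h2 fun t ht => by
      rw [← show (0 : ℝ) = t from ht, neg_zero, hγ.map_zero, hγ'.map_zero]
  · change f (if 0 ≤ t then γ t else γ' (-t)) = _
    split_ifs with h
    · rw [hγ.map_eq t (ha.trans_le h), one_smul]
    · rw [hγ'.map_eq (-t) (show a' < -t by linarith), neg_one_smul, geod_neg, neg_neg]

end Complete

/-! ### Asymptotic curves are geodesics to the vertex -/

section AsymptoticCurves

variable {f : M → L4} {N : L4} [IsManifold (𝓡 2) ω M]

/-- The direction of the rulings as an abstract tangent vector: it points to the vertex, and the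
unit normal is stationary along it. -/
theorem exists_tangent_toward (hf : IsSurface ω f) (hflat : IsExtrinsicallyFlat f)
    (hdir : IsDirectedTo f N) (q : M) : ∃ w : TangentSpace (𝓡 2) q,
      diff f q w = toward N (f q) ∧ ∀ U ν, IsUnitNormal f U ν → q ∈ U → diff ν q w = 0 := by
  obtain ⟨φ, c, v, hR, hp, hT⟩ := hdir q
  obtain ⟨x, hx, rfl⟩ : ∃ x ∈ φ.target, φ.symm x = q := ⟨φ q, φ.map_source hp, φ.left_inv hp⟩
  exact ⟨chartDeriv φ x (coordVec 1), (hR.diff_coordVec_one hf hx).trans (hT x hx),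
    fun U ν hν hU => hR.normalDeriv_one hf hflat hν hx hU⟩

/-- The direction of the rulings is in the kernel of the second fundamental form, which the velocity
of an asymptotic curve spans. -/
theorem IsAsymptoticCurve.diff_velocity (hf : IsSurface ω f) (hflat : IsExtrinsicallyFlat f)
    (hN : IsFutureNull N) (hdir : IsDirectedTo f N) {I : Set ℝ} {γ : ℝ → M}
    (hγ : IsAsymptoticCurve f I γ) {t : ℝ} (ht : t ∈ I) :
    ∃ r : ℝ, (r = 1 ∨ r = -1) ∧ diff f (γ t) (velocity γ t) = r • toward N (f (γ t)) := by
  obtain ⟨w, hw, hker⟩ := exists_tangent_toward hf hflat hdir (γ t)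
  obtain ⟨U, ν, hν, hU⟩ := exists_isUnitNormal hf (γ t)
  obtain ⟨r, hr⟩ := (hγ.kernel U ν hν t ht hU w).1 fun u => by
    rw [secondForm, hker U ν hν hU, lorentz_zero_left, neg_zero]
  have h1 := (hN.isUnitTangent_toward (hf.mem_H3 (γ t))).2.2
  have h2 := hγ.arcLength t ht
  rw [firstForm] at h2
  rw [hr, map_smul] at hw
  rw [← hw, lorentz_smul_left, lorentz_smul_right, h2] at h1
  have h3 := mul_self_eq_one_iff.1 (by linarith : r * r = 1)
  refine ⟨r, h3, ?_⟩
  rw [← hw, smul_smul]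
  rcases h3 with rfl | rfl <;> simp

/-- The integral curves of the vector field `toward N` of hyperbolic space are geodesics. -/
theorem eq_geod_of_hasDerivAt_toward (hN : IsFutureNull N) {k : ℝ → L4} (hk : ∀ t, k t ∈ H3)
    (hk' : ∀ t, HasDerivAt k (toward N (k t)) t) (t : ℝ) :
    k t = geod (k 0) (toward N (k 0)) t := by
  have hneg (t) := hN.lorentz_neg (hk t)
  -- `⟨N, k⟩' = -⟨N, k⟩`, which makes the equation `k' = -⟨N, k⟩⁻¹ N - k` an explicit linear one
  have h1 : ∀ t, HasDerivAt (fun t => Real.exp t * lorentz N (k t)) 0 t := by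
    intro t
    have := (Real.hasDerivAt_exp t).mul ((hasDerivAt_const t N).lorentz (hk' t))
    refine this.congr_deriv ?_
    rw [lorentz_zero_left, lorentz_toward hN]; ring
  have h2 : ∀ t, Real.exp t * lorentz N (k t) = lorentz N (k 0) := by
    intro t
    have := is_const_of_deriv_eq_zero (fun t => (h1 t).differentiableAt) (fun t => (h1 t).deriv) t 0
    simpa using this
  have h3 : ∀ t, HasDerivAt (fun t => Real.exp t • k t
      - (Real.exp t * Real.exp t / 2 * (-lorentz N (k 0))⁻¹) • N) 0 t := by
    intro t
    have he := Real.hasDerivAt_exp t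
    refine ((he.smul (hk' t)).sub
      ((((he.mul he).div_const 2).mul_const (-lorentz N (k 0))⁻¹).smul_const N)).congr_deriv ?_
    have : (-lorentz N (k t))⁻¹ = Real.exp t * (-lorentz N (k 0))⁻¹ := by
      rw [← h2 t]
      have := (hneg t).ne
      have := Real.exp_ne_zero t
      field_simp
    rw [toward, this]
    module
  have h4 := is_const_of_deriv_eq_zero (fun t => (h3 t).differentiableAt)
    (fun t => (h3 t).deriv) t 0
  simp only [Real.exp_zero, one_mul, one_smul] at h4
  have h5 : Real.exp t • k t = Real.exp t • geod (k 0) (toward N (k 0)) t := by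
    rw [sub_eq_iff_eq_add.1 h4, geod, Real.cosh_eq, Real.sinh_eq, toward]
    have e : Real.exp t * Real.exp (-t) = 1 := by rw [← Real.exp_add]; simp
    ext i
    simp only [Pi.add_apply, Pi.sub_apply, Pi.smul_apply, smul_eq_mul]
    linear_combination ((-lorentz N (k 0))⁻¹ * N i / 2 - k 0 i) * e
  exact smul_right_injective L4 (Real.exp_ne_zero t) h5

/-- A complete asymptotic curve, suitably oriented, is a geodesic that ends at the vertex. -/
theorem IsAsymptoticCurve.exists_eq_geod (hf : IsSurface ω f) (hflat : IsExtrinsicallyFlat f)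
    (hN : IsFutureNull N) (hdir : IsDirectedTo f N) {γ : ℝ → M}
    (hγ : IsAsymptoticCurve f Set.univ γ) : ∃ σ : ℝ, (σ = 1 ∨ σ = -1) ∧
      ∀ t, f (γ (σ * t)) = geod (f (γ 0)) (toward N (f (γ 0))) t := by
  have hγc : ContMDiff 𝓘(ℝ, ℝ) (𝓡 2) ∞ γ := contMDiffOn_univ.1 hγ.contMDiffOn
  have hder (t : ℝ) : HasDerivAt (fun s => f (γ s)) (diff f (γ t) (velocity γ t)) t :=
    hasDerivAt_comp_curve hf (hγc.contMDiffAt.mdifferentiableAt (by simp))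
  choose r hr hrv using fun t => hγ.diff_velocity hf hflat hN hdir (Set.mem_univ t)
  simp only [hrv] at hder
  have hsm : ContDiff ℝ ∞ fun s => f (γ s) :=
    ((hf.contMDiff.of_le le_top).comp hγc).contDiff
  -- the sign is constant, since `⟨N, (f ∘ γ)'⟩` is continuous without zeros
  have hcont : Continuous fun t => lorentz N (deriv (fun s => f (γ s)) t) :=
    continuous_lorentz.comp (continuous_const.prodMk (hsm.continuous_deriv (by simp)))
  have hval (t) : lorentz N (deriv (fun s => f (γ s)) t) = r t * -lorentz N (f (γ t)) := by
    rw [(hder t).deriv, lorentz_smul_right, lorentz_toward hN]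
  have hneg (t) := hN.lorentz_neg (hf.mem_H3 (γ t))
  have hconst (t) : r t = r 0 := by
    have key (s t : ℝ) (hs : r s = 1) (ht : r t = -1) : False := by
      obtain ⟨z, hz⟩ := mem_range_of_exists_le_of_exists_ge hcont (c := 0)
        ⟨t, by rw [hval, ht]; linarith [hneg t]⟩ ⟨s, by rw [hval, hs]; linarith [hneg s]⟩
      simp only [hval] at hz
      have hz' := hneg z
      rcases hr z with h | h <;> rw [h] at hz <;> linarith
    rcases hr t with h | h <;> rcases hr 0 with h' | h'
    · rw [h, h']
    · exact (key _ _ h h').elim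
    · exact (key _ _ h' h).elim
    · rw [h, h']
  refine ⟨r 0, hr 0, fun t => ?_⟩
  have := eq_geod_of_hasDerivAt_toward hN (k := fun t => f (γ (r 0 * t)))
    (fun t => hf.mem_H3 _) (fun t => ?_) t
  · simpa using this
  · have h1 := (hder (r 0 * t)).scomp t ((hasDerivAt_id t).const_mul (r 0))
    refine h1.congr_deriv ?_
    rw [hconst (r 0 * t), smul_smul, mul_one]
    rcases hr 0 with h | h <;> rw [h] <;> simp

end AsymptoticCurves

end HypSurf

end

theorem theoremB {M : Type*} [TopologicalSpace M] [T2Space M] [SecondCountableTopology M]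
    [ConnectedSpace M] [ChartedSpace (EuclideanSpace ℝ (Fin 2)) M] [IsManifold (𝓡 2) ω M]
    (f : M → HypSurf.L4) (hf : HypSurf.IsSurface ω f) (hexp : HypSurf.IsExponentialType f) :
    HypSurf.IsIdealCone f ∧
      ∃ ε : (ℝ → M) → ℝ, (∀ γ, ε γ = 1 ∨ ε γ = -1) ∧
        ∀ γ₁ γ₂ : ℝ → M, HypSurf.IsAsymptoticCurve f Set.univ γ₁ →
          HypSurf.IsAsymptoticCurve f Set.univ γ₂ →
          HypSurf.Asymptotic (fun t => f (γ₁ (ε γ₁ * t))) (fun t => f (γ₂ (ε γ₂ * t))) := by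
  obtain ⟨N, hN, hνN⟩ := HypSurf.exists_vertex hf hexp
  have hdir : HypSurf.IsDirectedTo f N :=
    HypSurf.isDirectedTo hf hexp.developable hexp.not_totally_umbilic hN hνN
  have hflat := hexp.developable.2
  let g (p : M) : HypSurf.UH3 :=
    ⟨(f p, HypSurf.toward N (f p)), hN.isUnitTangent_toward (hf.mem_H3 p)⟩
  have hg (p : M) : (g p).1.1 + (g p).1.2 = (-HypSurf.lorentz N (f p))⁻¹ • N :=
    HypSurf.add_toward N (f p)
  obtain ⟨p₀⟩ : Nonempty M := inferInstance
  refine ⟨⟨hexp.complete, hexp.developable, (g p₀).endpoint, fun p => ?_, fun p => ?_⟩, ?_⟩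
  · obtain ⟨φ, c, v, hR, hp, hT⟩ := hdir p
    exact ⟨φ, c, v, hR, hp, fun x hx => ⟨hR.isUnitTangent x hx, Quotient.sound
      (HypSurf.asymptotic_of_add_eq_smul _ _ hN
        (HypSurf.add_eq_smul_of_ruledT_eq hR hx (hT x hx)) (hg p₀))⟩⟩
  · obtain ⟨γ, hγ, hγ0, hγg⟩ := HypSurf.exists_complete_ruling hf hexp.complete hN hdir p
    exact ⟨γ, g p, hγ, hγ0, hγg, Quotient.sound
      (HypSurf.asymptotic_of_add_eq_smul _ _ hN (hg p) (hg p₀))⟩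
  · have key (γ : ℝ → M) : ∃ ε : ℝ, (ε = 1 ∨ ε = -1) ∧
        (HypSurf.IsAsymptoticCurve f Set.univ γ →
          (fun t => f (γ (ε * t))) = (g (γ 0)).curve) := by
      by_cases hγ : HypSurf.IsAsymptoticCurve f Set.univ γ
      · obtain ⟨σ, hσ, h⟩ := hγ.exists_eq_geod hf hflat hN hdir
        exact ⟨σ, hσ, fun _ => funext h⟩
      · exact ⟨1, Or.inl rfl, fun h => (hγ h).elim⟩
    choose ε hε hεg using key
    refine ⟨ε, hε, fun γ₁ γ₂ h₁ h₂ => ?_⟩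
    rw [hεg γ₁ h₁, hεg γ₂ h₂]
    exact HypSurf.asymptotic_of_add_eq_smul _ _ hN (hg _) (hg _)
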